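/- Let $d\ge 1$ and let $\Omega\subset\mathbb{R}^d$ be a bounded Lipschitz domain, i.e. a nonempty bounded open set such that for every $x\in\partial\Omega$ there are $r>0$, an isometry $T$ of $\mathbb{R}^d$ and a Lipschitz function $\phi:\mathbb{R}^{d-1}\to\mathbb{R}$ with $$T(\Omega)\cap B_r(T(x))=\{\xi=(\xi',\xi_d):\ \xi_d>\phi(\xi')\}\cap B_r(T(x)).$$ (Connectedness is not required.) Put $\delta_\Omega(x)=\min_{y\in\partial\Omega}|x-y|$, $\mathcal L_1(t)=\frac{1}{1-\ln t}$ for $t\in(0,1)$ and $\mathcal L_m(t)=\mathcal L_1(\mathcal L_{m-1}(t))$ for $m\ge 2$. For $0<s<1$ let $$[u]_{W^{s,1}(\Omega)}=\int_\Omega\int_\Omega\frac{|u(x)-u(y)|}{|x-y|^{d+s}}\,dx\,dy,\qquad W^{s,1}(\Omega)=\{u\in L^1(\Omega):[u]_{W^{s,1}(\Omega)}<\infty\},$$ and for $R>0$ with $\delta_\Omega(x)<R$ for all $x\in\Omega$, $m\ge 2$ and $u\in W^{s,1}(\Omega)$ let $$I_{m,s,R}(u)=\int_\Omega\frac{|u(x)|}{\delta_\Omega(x)^s}\,\mathcal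 L_1\!\left(\tfrac{\delta_\Omega(x)}{R}\right)\cdots\mathcal L_{m-1}\!\left(\tfrac{\delta_\Omega(x)}{R}\right)\mathcal L_m^2\!\left(\tfrac{\delta_\Omega(x)}{R}\right)dx\in[0,\infty].$$ (i) There is a constant $C=C(d,\Omega)>0$ such that for all $R>0$ with $\delta_\Omega<R$ on $\Omega$, all integers $m\ge2$, all $s\in[\frac12,1)$ and all $u\in W^{s,1}(\Omega)$, $$I_{m,s,R}(u)\le C\,2^m\left\{(1-s)[u]_{W^{s,1}(\Omega)}+\|u\|_{L^1(\Omega)}\right\}.$$ (ii) There is a constant $C=C(d,\Omega)>0$ such that for all $R>0$ with $\delta_\Omega<R$ on $\Omega$, all $\alpha\in(0,\frac12)$, all $s\in[\frac12,1)$ and all $u\in W^{s,1}(\Omega)$, $$\sum_{m=2}^\infty\alpha^m I_{m,s,R}(u)\le C\,\frac{4\alpha^2}{1-2\alpha}\left\{(1-s)[u]_{W^{s,1}(\Omega)}+\|u\|_{L^1(\Omega)}\right\}.$$ (iii) The series inequality fails for $\alpha\ge1$: for every $R>0$ with $\delta_\Omega<R$ on $\Omega$ and every $\alpha\ge1$ there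 is no constant $C>0$ (even depending on $d,\Omega,R,\alpha$) such that for all $s\in[\frac12,1)$ and all $u\in W^{s,1}(\Omega)$, $$\sum_{m=2}^\infty\alpha^m I_{m,s,R}(u)\le C\left\{(1-s)[u]_{W^{s,1}(\Omega)}+\|u\|_{L^1(\Omega)}\right\}.$$ -/

import Mathlib

open MeasureTheory

noncomputable section

namespace BoundaryHardy

/-- The distance `δ_Ω(x)` from `x` to the boundary of `Ω`. -/
def bdist {d : ℕ} (Ω : Set (EuclideanSpace ℝ (Fin d))) (x : EuclideanSpace ℝ (Fin d)) : ℝ :=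
  Metric.infDist x (frontier Ω)

/-- `ξ'`, the first `n` coordinates of a point `ξ = (ξ', ξ_{n+1})` of `ℝ^{n+1}`. -/
def initCoords {n : ℕ} (ξ : EuclideanSpace ℝ (Fin (n + 1))) : EuclideanSpace ℝ (Fin n) :=
  WithLp.toLp 2 fun i => ξ i.castSucc

/-- Bounded Lipschitz domains of `ℝ^{n+1}`: non-empty bounded open sets which, near every boundary
point and after an isometry of the space, are the region above the graph of a Lipschitz function
of the first `n` coordinates. Connectedness is not required. -/
structure IsBoundedLipschitzDomain {n : ℕ} (Ω : Set (EuclideanSpace ℝ (Fin (n + 1)))) :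
    Prop where
  isOpen : IsOpen Ω
  nonempty : Ω.Nonempty
  isBounded : Bornology.IsBounded Ω
  exists_graph : ∀ x ∈ frontier Ω, ∃ r : ℝ, 0 < r ∧
    ∃ (T : EuclideanSpace ℝ (Fin (n + 1)) ≃ᵢ EuclideanSpace ℝ (Fin (n + 1)))
      (φ : EuclideanSpace ℝ (Fin n) → ℝ),
      (∃ K : NNReal, LipschitzWith K φ) ∧
      (T '' Ω) ∩ Metric.ball (T x) r =
        {ξ | φ (initCoords ξ) < ξ (Fin.last n)} ∩ Metric.ball (T x) r

/-- `𝓛₁(t) = 1 / (1 - ln t)`. -/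
def logL₁ (t : ℝ) : ℝ := 1 / (1 - Real.log t)

/-- The iterated functions `𝓛_m`: `𝓛_m(t) = 𝓛₁(𝓛_{m-1}(t))`, with the convention `𝓛_0(t) = t`,
so that `logL 1 = logL₁`. -/
def logL : ℕ → ℝ → ℝ
  | 0, t => t
  | m + 1, t => logL₁ (logL m t)

/-- The weight `𝓛₁(t) ⋯ 𝓛_{m-1}(t) · 𝓛_m(t)²`. -/
def logWeight (m : ℕ) (t : ℝ) : ℝ :=
  (∏ i ∈ Finset.Ico 1 m, logL i t) * logL m t ^ 2

/-- The Gagliardo seminorm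
`[u]_{W^{s,1}(Ω)} = ∫_Ω ∫_Ω |u(x) - u(y)| / |x - y|^{d+s} dx dy`, with values in `[0, ∞]`. -/
def gagliardo {d : ℕ} (s : ℝ) (Ω : Set (EuclideanSpace ℝ (Fin d)))
    (u : EuclideanSpace ℝ (Fin d) → ℝ) : ENNReal :=
  ∫⁻ x in Ω, ∫⁻ y in Ω, ENNReal.ofReal (|u x - u y| / ‖x - y‖ ^ ((d : ℝ) + s))

/-- `u ∈ W^{s,1}(Ω)`: `u ∈ L¹(Ω)` and `[u]_{W^{s,1}(Ω)} < ∞`. -/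
def MemWs1 {d : ℕ} (s : ℝ) (Ω : Set (EuclideanSpace ℝ (Fin d)))
    (u : EuclideanSpace ℝ (Fin d) → ℝ) : Prop :=
  MemLp u 1 (volume.restrict Ω) ∧ gagliardo s Ω u < ⊤

/-- `‖u‖_{L¹(Ω)}`, with values in `[0, ∞]`. -/
def normL1 {d : ℕ} (Ω : Set (EuclideanSpace ℝ (Fin d)))
    (u : EuclideanSpace ℝ (Fin d) → ℝ) : ENNReal :=
  eLpNorm u 1 (volume.restrict Ω)

/-- The Hardy integral
`∫_Ω |u| / δ_Ω^s · 𝓛₁(δ_Ω/R) ⋯ 𝓛_{m-1}(δ_Ω/R) · 𝓛_m(δ_Ω/R)² dx`, with values in `[0, ∞]`. -/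
def hardyInt {d : ℕ} (s R : ℝ) (m : ℕ) (Ω : Set (EuclideanSpace ℝ (Fin d)))
    (u : EuclideanSpace ℝ (Fin d) → ℝ) : ENNReal :=
  ∫⁻ x in Ω, ENNReal.ofReal (|u x| / bdist Ω x ^ s * logWeight m (bdist Ω x / R))

/-- The series `∑_{m ≥ 2} α^m ∫_Ω |u| / δ_Ω^s · 𝓛₁ ⋯ 𝓛_{m-1} 𝓛_m² (δ_Ω/R) dx`, in `[0, ∞]`. -/
def hardySeries {d : ℕ} (s R α : ℝ) (Ω : Set (EuclideanSpace ℝ (Fin d)))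
    (u : EuclideanSpace ℝ (Fin d) → ℝ) : ENNReal :=
  ∑' k : ℕ, ENNReal.ofReal (α ^ (k + 2)) * hardyInt s R (k + 2) Ω u

end BoundaryHardy

end

/-!
The Hardy weight comes from a derivative: `(𝓛_m)'(t) = 𝓛₁(t) ⋯ 𝓛_{m-1}(t) 𝓛_m(t)² / t`
(`hasDerivAt_logL`), and `0 < 𝓛_m ≤ 1` on `(0, 1]`. So the weights at the dyadic points `2⁻ᵏ` have a
sum bounded independently of `m` (`tsum_logWeight_le`), but it does not decay in `m` either, because
`𝓛_m(t) ≥ t` (`exists_le_sum_logWeight`). The first fact gives the inequalities, even with a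
constant independent of `m` for the single integrals, and the second one their failure for `α ≥ 1`.

*Upper bound.* Near a boundary point, `Ω` is the set where a height function `h` is positive, `h`
growing with unit speed in a direction `e` and being comparable with the distance to the boundary
(`IsGraphChart`). Cut this part of `Ω` into dyadic slabs, of height about `2⁻ᵏ`. A slab is the union
of two vertical translates of the next one, so translation invariance of Lebesgue measure shows that
the rescaled mass `2^{ks} ∫ |u|` over the `k`-th slab exceeds that over the preceding slab by no more
than an integral of vertical increments of `u` (`IsGraphChart.slab_mass_succ_le`). Such increments
are bounded by `1 - s` times the seminorm over a layer of `Ω` at the same heights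
(`IsGraphChart.lintegral_vertical_increment_le`), and the layers overlap at most three times. Hence
all rescaled masses are bounded by `‖u‖ + C (1 - s) [u]`, and summing them against the weights
proves the inequality locally. Compactness of `closure Ω` makes it global.

The factor `1 - s`, uniform as `s → 1`, is due to `lintegral_ball_increment_le`: subdividing segments
into `2ˡ` parts bounds the same integral of increments by disjoint parts of the double integral
defining the seminorm, with weights `2^{-l(1-s)}` whose sum is at least `1 / (1 - s)`.

*Failure for `α ≥ 1`.* For `u = 1` the seminorm vanishes, while the `m`-th integral is at least a
constant times `∑ₖ 2^{-k(1-s)} w_m(b 2⁻ᵏ)`, where `w_m` is the weight. As `s → 1` this exceeds a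
positive number that does not depend on `m`, so the series is unbounded.
-/

namespace BoundaryHardy

open Set Filter Topology

/-! ### Iterated logarithmic weights -/

lemma logL₁_mem {t : ℝ} (ht : t ∈ Ioc (0 : ℝ) 1) : logL₁ t ∈ Ioc (0 : ℝ) 1 := by
  have h : Real.log t ≤ 0 := Real.log_nonpos ht.1.le ht.2
  refine ⟨by unfold logL₁; apply one_div_pos.2; linarith, ?_⟩
  unfold logL₁
  rw [div_le_one (by linarith)]
  linarith

lemma logL_mem (m : ℕ) {t : ℝ} (ht : t ∈ Ioc (0 : ℝ) 1) : logL m t ∈ Ioc (0 : ℝ) 1 := by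
  induction m with
  | zero => exact ht
  | succ m ih => exact logL₁_mem ih

lemma logL₁_mono {x y : ℝ} (hx : 0 < x) (hxy : x ≤ y) (hy : y ≤ 1) : logL₁ x ≤ logL₁ y := by
  have h : Real.log y ≤ 0 := Real.log_nonpos (hx.trans_le hxy).le hy
  have h' : Real.log x ≤ Real.log y := Real.log_le_log hx hxy
  unfold logL₁
  exact one_div_le_one_div_of_le (by linarith) (by linarith)

lemma logL_mono (m : ℕ) {x y : ℝ} (hx : 0 < x) (hxy : x ≤ y) (hy : y ≤ 1) :
    logL m x ≤ logL m y := by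
  induction m with
  | zero => exact hxy
  | succ m ih =>
    exact logL₁_mono (logL_mem m ⟨hx, hxy.trans hy⟩).1 ih (logL_mem m ⟨hx.trans_le hxy, hy⟩).2

lemma le_logL₁ {t : ℝ} (ht : t ∈ Ioc (0 : ℝ) 1) : t ≤ logL₁ t := by
  have h : Real.log t ≤ 0 := Real.log_nonpos ht.1.le ht.2
  have h2 := Real.one_sub_inv_le_log_of_pos ht.1
  unfold logL₁
  rw [le_div_iff₀ (by linarith)]
  have : t * (1 - t⁻¹) ≤ t * Real.log t := mul_le_mul_of_nonneg_left h2 ht.1.le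
  rw [mul_sub, mul_inv_cancel₀ ht.1.ne'] at this
  linarith

lemma le_logL (m : ℕ) {t : ℝ} (ht : t ∈ Ioc (0 : ℝ) 1) : t ≤ logL m t := by
  induction m with
  | zero => exact le_rfl
  | succ m ih => exact ih.trans (le_logL₁ (logL_mem m ht))

lemma logWeight_nonneg (m : ℕ) {t : ℝ} (ht : t ∈ Ioc (0 : ℝ) 1) : 0 ≤ logWeight m t :=
  mul_nonneg (Finset.prod_nonneg fun i _ => (logL_mem i ht).1.le) (sq_nonneg _)

lemma logWeight_mono (m : ℕ) {x y : ℝ} (hx : 0 < x) (hxy : x ≤ y) (hy : y ≤ 1) :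
    logWeight m x ≤ logWeight m y := by
  have hx1 : x ∈ Ioc (0 : ℝ) 1 := ⟨hx, hxy.trans hy⟩
  unfold logWeight
  gcongr with i hi
  · exact Finset.prod_nonneg fun i _ => (logL_mem i ⟨hx.trans_le hxy, hy⟩).1.le
  · exact fun i _ => (logL_mem i hx1).1.le
  · exact logL_mono i hx hxy hy
  · exact (logL_mem m hx1).1.le
  · exact logL_mono m hx hxy hy

lemma logWeight_le_one (m : ℕ) {t : ℝ} (ht : t ∈ Ioc (0 : ℝ) 1) : logWeight m t ≤ 1 := by
  refine mul_le_one₀ (Finset.prod_le_one (fun i _ => (logL_mem i ht).1.le)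
    fun i _ => (logL_mem i ht).2) (sq_nonneg _) ?_
  exact pow_le_one₀ (logL_mem m ht).1.le (logL_mem m ht).2

/-- The identity behind the Hardy weight: `t ↦ 𝓛₁ ⋯ 𝓛_{m-1} 𝓛_m² / t` is the derivative of the
bounded function `𝓛_m`. -/
lemma hasDerivAt_logL (m : ℕ) {t : ℝ} (ht : t ∈ Ioc (0 : ℝ) 1) :
    HasDerivAt (logL (m + 1)) (logWeight (m + 1) t / t) t := by
  have key : ∀ x ∈ Ioc (0 : ℝ) 1, HasDerivAt logL₁ (logL₁ x ^ 2 / x) x := by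
    intro x hx
    have h : Real.log x ≤ 0 := Real.log_nonpos hx.1.le hx.2
    have h1 := (((Real.hasDerivAt_log hx.1.ne').const_sub 1).inv (by linarith))
    have h2 : logL₁ = (fun y => 1 - Real.log y)⁻¹ := by
      funext y; simp [logL₁]
    have h3 : logL₁ x = (1 - Real.log x)⁻¹ := by rw [h2]; rfl
    rw [h3, h2]
    refine h1.congr_deriv ?_
    have := hx.1.ne'
    have : 1 - Real.log x ≠ 0 := by linarith
    field_simp
  induction m with
  | zero =>
    have := key t ht
    simpa [logWeight, logL] using this
  | succ m ih =>
    have hm := logL_mem (m + 1) ht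
    have h := (key _ hm).comp t ih
    refine h.congr_deriv ?_
    have e1 : logL₁ (logL (m + 1) t) = logL (m + 2) t := rfl
    rw [e1]
    unfold logWeight
    rw [Finset.prod_Ico_succ_top (by omega : 1 ≤ m + 1)]
    have := hm.1.ne'
    have := ht.1.ne'
    field_simp

lemma exists_logL_two_mul_sub (m : ℕ) {x : ℝ} (hx : 0 < x) (hx1 : 2 * x ≤ 1) :
    ∃ c ∈ Ioo x (2 * x), logL (m + 1) (2 * x) - logL (m + 1) x =
      logWeight (m + 1) c / c * x := by
  have hd : ∀ y ∈ Icc x (2 * x), HasDerivAt (logL (m + 1)) (logWeight (m + 1) y / y) y :=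
    fun y hy => hasDerivAt_logL m ⟨hx.trans_le hy.1, hy.2.trans hx1⟩
  obtain ⟨c, hc, h⟩ := exists_hasDerivAt_eq_slope (logL (m + 1))
    (fun y => logWeight (m + 1) y / y) (by linarith : x < 2 * x)
    (fun y hy => (hd y hy).continuousAt.continuousWithinAt)
    (fun y hy => hd y ⟨hy.1.le, hy.2.le⟩)
  refine ⟨c, hc, ?_⟩
  have h3 : 2 * x - x = x := by ring
  rw [h, h3]
  field_simp

lemma logWeight_le_logL_sub (m : ℕ) {x : ℝ} (hx : 0 < x) (hx1 : 2 * x ≤ 1) :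
    logWeight (m + 1) x ≤ 2 * (logL (m + 1) (2 * x) - logL (m + 1) x) := by
  obtain ⟨c, hc, h⟩ := exists_logL_two_mul_sub m hx hx1
  have hc0 : 0 < c := hx.trans hc.1
  have h1 := logWeight_mono (m + 1) hx hc.1.le (hc.2.le.trans hx1)
  have h0 := logWeight_nonneg (m + 1) (t := x) ⟨hx, by linarith⟩
  rw [h, div_mul_eq_mul_div, mul_div_assoc', le_div_iff₀ hc0]
  nlinarith [hc.2, mul_nonneg (sub_nonneg.2 h1) hx.le, mul_nonneg h0 (sub_nonneg.2 hc.2.le)]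

lemma logL_sub_le_logWeight (m : ℕ) {x : ℝ} (hx : 0 < x) (hx1 : 2 * x ≤ 1) :
    logL (m + 1) (2 * x) - logL (m + 1) x ≤ logWeight (m + 1) (2 * x) := by
  obtain ⟨c, hc, h⟩ := exists_logL_two_mul_sub m hx hx1
  have hc0 : 0 < c := hx.trans hc.1
  have h1 := logWeight_mono (m + 1) hc0 hc.2.le hx1
  have h0 := logWeight_nonneg (m + 1) (t := c) ⟨hc0, hc.2.le.trans hx1⟩
  rw [h, div_mul_eq_mul_div, div_le_iff₀ hc0]
  nlinarith [hc.1, mul_le_mul h1 hc.1.le hx.le (h0.trans h1)]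

/-- The weights at the dyadic points have a sum bounded independently of `m`. This is where the
divergence of `∫ dt / t` is compensated. -/
lemma tsum_logWeight_le (m : ℕ) (hm : 1 ≤ m) :
    ∑' k : ℕ, ENNReal.ofReal (logWeight m ((1 / 2) ^ k)) ≤ 3 := by
  obtain ⟨m, rfl⟩ : ∃ l, m = l + 1 := ⟨m - 1, by omega⟩
  have hp : ∀ k : ℕ, ((1 : ℝ) / 2) ^ k ∈ Ioc (0 : ℝ) 1 := fun k =>
    ⟨by positivity, pow_le_one₀ (by norm_num) (by norm_num)⟩
  refine ENNReal.tsum_le_of_sum_range_le fun N => ?_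
  rw [← ENNReal.ofReal_sum_of_nonneg fun k _ => logWeight_nonneg _ (hp k)]
  refine ENNReal.ofReal_le_of_le_toReal ?_
  have key : ∀ N : ℕ, ∑ k ∈ Finset.range (N + 1), logWeight (m + 1) ((1 / 2) ^ k) ≤
      1 + 2 * (1 - logL (m + 1) ((1 / 2) ^ N)) := by
    intro N
    induction N with
    | zero =>
      have h1 := logWeight_le_one (m + 1) (hp 0)
      have h2 := (logL_mem (m + 1) (hp 0)).2
      rw [zero_add, Finset.sum_range_one]
      linarith
    | succ N ih =>
      rw [Finset.sum_range_succ]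
      have e : 2 * ((1 : ℝ) / 2) ^ (N + 1) = (1 / 2) ^ N := by rw [pow_succ]; ring
      have h := logWeight_le_logL_sub m (hp (N + 1)).1 (by rw [e]; exact (hp N).2)
      rw [e] at h
      linarith
  have h3 : (3 : ENNReal).toReal = 3 := rfl
  rw [h3]
  calc _ ≤ ∑ k ∈ Finset.range (N + 1), logWeight (m + 1) ((1 / 2) ^ k) := by
        rw [Finset.sum_range_succ]
        linarith [logWeight_nonneg (m + 1) (hp N)]
    _ ≤ _ := key N
    _ ≤ 3 := by linarith [(logL_mem (m + 1) (hp N)).1]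

lemma tendsto_logL (m : ℕ) : Tendsto (logL m) (𝓝[>] 0) (𝓝[>] 0) := by
  induction m with
  | zero => exact tendsto_id
  | succ m ih =>
    refine Tendsto.comp (g := logL₁) ?_ ih
    have h : Tendsto (fun t : ℝ => 1 - Real.log t) (𝓝[>] 0) atTop := by
      have := tendsto_atTop_add_const_left _ (1 : ℝ)
        (tendsto_neg_atBot_atTop.comp Real.tendsto_log_nhdsGT_zero)
      simpa [sub_eq_add_neg, Function.comp_def] using this
    have h2 := tendsto_inv_atTop_nhdsGT_zero.comp h
    refine h2.congr fun t => ?_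
    simp [logL₁]

/-- The dyadic sums of the weights exhaust `𝓛_m(c) ≥ c`, and so do not decay in `m`. -/
lemma exists_le_sum_logWeight (m : ℕ) (hm : 1 ≤ m) {c : ℝ} (hc : c ∈ Ioc (0 : ℝ) 1) :
    ∃ N : ℕ, c / 2 ≤ ∑ k ∈ Finset.range N, logWeight m (c * (1 / 2) ^ k) := by
  obtain ⟨m, rfl⟩ : ∃ l, m = l + 1 := ⟨m - 1, by omega⟩
  have hp : ∀ k : ℕ, c * ((1 : ℝ) / 2) ^ k ∈ Ioc (0 : ℝ) 1 := fun k =>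
    ⟨mul_pos hc.1 (by positivity),
      mul_le_one₀ hc.2 (by positivity) (pow_le_one₀ (by norm_num) (by norm_num))⟩
  have key : ∀ N : ℕ, logL (m + 1) c - logL (m + 1) (c * (1 / 2) ^ N) ≤
      ∑ k ∈ Finset.range N, logWeight (m + 1) (c * (1 / 2) ^ k) := by
    intro N
    induction N with
    | zero => simp
    | succ N ih =>
      rw [Finset.sum_range_succ]
      have e : 2 * (c * ((1 : ℝ) / 2) ^ (N + 1)) = c * (1 / 2) ^ N := by rw [pow_succ]; ring
      have h := logL_sub_le_logWeight m (hp (N + 1)).1 (by rw [e]; exact (hp N).2)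
      rw [e] at h
      linarith
  have h0 : Tendsto (fun N : ℕ => c * ((1 : ℝ) / 2) ^ N) atTop (𝓝[>] 0) := by
    refine tendsto_nhdsWithin_iff.2 ⟨?_, Eventually.of_forall fun N => (hp N).1⟩
    have := (tendsto_pow_atTop_nhds_zero_of_lt_one (r := (1 : ℝ) / 2)
      (by norm_num) (by norm_num)).const_mul c
    simpa using this
  have h1 : Tendsto (fun N : ℕ => logL (m + 1) (c * ((1 : ℝ) / 2) ^ N)) atTop (𝓝 0) :=
    ((tendsto_logL (m + 1)).comp h0).mono_right nhdsWithin_le_nhds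
  obtain ⟨N, hN⟩ := (h1.eventually (gt_mem_nhds (half_pos hc.1))).exists
  exact ⟨N, by linarith [key N, le_logL (m + 1) hc]⟩

/-! ### Increments and the Gagliardo seminorm -/

section Segments

variable {d : ℕ}

/-- The contribution of the pair `(x, y)` to the seminorm `gagliardo s Z u`, extended by zero
outside `Z × Z`. -/
noncomputable def gagliardoKernel (s : ℝ) (Z : Set (EuclideanSpace ℝ (Fin d))) (u : EuclideanSpace ℝ (Fin d) → ℝ)
    (x y : EuclideanSpace ℝ (Fin d)) : ENNReal :=
  Z.indicator (fun x => Z.indicator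
    (fun y => ENNReal.ofReal (|u x - u y| / ‖x - y‖ ^ ((d : ℝ) + s))) y) x

/-- The `L¹` size of the increments `u (x + v) - u x` with both `x` and `x + v` in `Z`. -/
noncomputable def incrementNorm (Z : Set (EuclideanSpace ℝ (Fin d))) (u : EuclideanSpace ℝ (Fin d) → ℝ)
    (v : EuclideanSpace ℝ (Fin d)) : ENNReal :=
  ∫⁻ x in Z ∩ (fun x => x + v) ⁻¹' Z, ENNReal.ofReal |u (x + v) - u x|

variable {s : ℝ} {u : EuclideanSpace ℝ (Fin d) → ℝ} {S Z : Set (EuclideanSpace ℝ (Fin d))}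

lemma measurableSet_inter_translate (hZ : MeasurableSet Z) (v : EuclideanSpace ℝ (Fin d)) :
    MeasurableSet (Z ∩ (fun x => x + v) ⁻¹' Z) :=
  hZ.inter (measurable_id.add_const v hZ)

lemma measurable_gagliardoKernel (hu : Measurable u) (hZ : MeasurableSet Z) :
    Measurable fun q : EuclideanSpace ℝ (Fin d) × EuclideanSpace ℝ (Fin d) =>
      gagliardoKernel s Z u q.1 q.2 := by
  have h : (fun q : EuclideanSpace ℝ (Fin d) × EuclideanSpace ℝ (Fin d) =>
      gagliardoKernel s Z u q.1 q.2) = (Z ×ˢ Z).indicator (fun q =>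
        ENNReal.ofReal (|u q.1 - u q.2| / ‖q.1 - q.2‖ ^ ((d : ℝ) + s))) := by
    funext q
    by_cases h1 : q.1 ∈ Z <;> by_cases h2 : q.2 ∈ Z <;>
      simp [gagliardoKernel, indicator, h1, h2]
  rw [h]
  refine Measurable.indicator ?_ (hZ.prod hZ)
  have h1 : Measurable fun q : EuclideanSpace ℝ (Fin d) × EuclideanSpace ℝ (Fin d) =>
    |u q.1 - u q.2| := ((hu.comp measurable_fst).sub (hu.comp measurable_snd)).abs
  have h2 : Measurable fun q : EuclideanSpace ℝ (Fin d) × EuclideanSpace ℝ (Fin d) =>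
    ‖q.1 - q.2‖ := (measurable_fst.sub measurable_snd).norm
  exact (h1.div (h2.pow_const _)).ennreal_ofReal

lemma lintegral_gagliardoKernel (hZ : MeasurableSet Z) :
    ∫⁻ x, ∫⁻ y, gagliardoKernel s Z u x y = gagliardo s Z u := by
  unfold gagliardo
  rw [← lintegral_indicator hZ]
  refine lintegral_congr fun x => ?_
  by_cases hx : x ∈ Z
  · simp only [gagliardoKernel, indicator_of_mem hx]
    rw [lintegral_indicator hZ]
  · simp [gagliardoKernel, indicator_of_notMem hx]

/-- The seminorm as an integral over the increments `v = y - x`. -/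
lemma lintegral_gagliardoKernel_add (hu : Measurable u) (hZ : MeasurableSet Z) :
    ∫⁻ v, ∫⁻ x, gagliardoKernel s Z u x (x + v) = gagliardo s Z u := by
  rw [← lintegral_gagliardoKernel hZ, lintegral_lintegral_swap]
  · exact lintegral_congr fun x => lintegral_add_left_eq_self (fun y => gagliardoKernel s Z u x y) x
  · refine Measurable.aemeasurable ?_
    exact (measurable_gagliardoKernel hu hZ).comp
      (measurable_snd.prodMk (measurable_snd.add measurable_fst))

lemma lintegral_comp_smul (r : ℝ) (hr : 0 < r) {F : EuclideanSpace ℝ (Fin d) → ENNReal}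
    (hF : Measurable F) :
    ∫⁻ v, F (r • v) = ENNReal.ofReal ((r ^ d)⁻¹) * ∫⁻ v, F v := by
  have h := Measure.map_addHaar_smul (volume : Measure (EuclideanSpace ℝ (Fin d))) hr.ne'
  rw [finrank_euclideanSpace_fin, abs_of_pos (by positivity)] at h
  rw [← lintegral_map hF (measurable_const_smul r), h, lintegral_smul_measure, smul_eq_mul]

/-- A translation by `v` is the composition of `2 ^ l` translations by `2⁻ˡ v`. -/
lemma lintegral_increment_le (hu : Measurable u) (hZ : MeasurableSet Z)
    {v : EuclideanSpace ℝ (Fin d)} (h : ∀ x ∈ S, ∀ θ ∈ Icc (0 : ℝ) 1, x + θ • v ∈ Z) (l : ℕ) :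
    ∫⁻ x in S, ENNReal.ofReal |u (x + v) - u x| ≤ 2 ^ l * incrementNorm Z u ((1 / 2 : ℝ) ^ l • v) := by
  set w := (1 / 2 : ℝ) ^ l • v with hw
  let g : EuclideanSpace ℝ (Fin d) → ENNReal :=
    (Z ∩ (fun x => x + w) ⁻¹' Z).indicator (fun x => ENNReal.ofReal |u (x + w) - u x|)
  have hZm := measurableSet_inter_translate hZ w
  have hg : Measurable g :=
    ((((hu.comp (measurable_id.add_const w)).sub hu).abs).ennreal_ofReal).indicator hZm
  have hN : ((2 ^ l : ℕ) : ℝ) • w = v := by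
    rw [hw, smul_smul]; push_cast; rw [← mul_pow]; norm_num
  have hseg : ∀ x ∈ S, ∀ i : ℕ, i ≤ 2 ^ l → x + (i : ℝ) • w ∈ Z := by
    intro x hx i hi
    have : (i : ℝ) • w = ((i : ℝ) * (1 / 2) ^ l) • v := by rw [hw, smul_smul]
    rw [this]
    refine h x hx _ ⟨by positivity, ?_⟩
    have hi' : (i : ℝ) ≤ 2 ^ l := by exact_mod_cast hi
    calc (i : ℝ) * (1 / 2) ^ l ≤ 2 ^ l * (1 / 2) ^ l := by gcongr
      _ = 1 := by rw [← mul_pow]; norm_num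
  have hpt : ∀ x ∈ S, ENNReal.ofReal |u (x + v) - u x| ≤
      ∑ i ∈ Finset.range (2 ^ l), g (x + (i : ℝ) • w) := by
    intro x hx
    have h1 : u (x + v) - u x =
        ∑ i ∈ Finset.range (2 ^ l), (u (x + ((i + 1 : ℕ) : ℝ) • w) - u (x + (i : ℝ) • w)) := by
      rw [Finset.sum_range_sub (fun i : ℕ => u (x + (i : ℝ) • w)), hN]
      simp
    rw [h1]
    refine (ENNReal.ofReal_le_ofReal (Finset.abs_sum_le_sum_abs _ _)).trans ?_
    rw [ENNReal.ofReal_sum_of_nonneg fun i _ => abs_nonneg _]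
    refine Finset.sum_le_sum fun i hi => ?_
    have hi := Finset.mem_range.1 hi
    have e : x + ((i + 1 : ℕ) : ℝ) • w = x + (i : ℝ) • w + w := by
      push_cast; rw [add_smul, one_smul, add_assoc]
    have hm : x + (i : ℝ) • w ∈ Z ∩ (fun x => x + w) ⁻¹' Z :=
      ⟨hseg x hx i hi.le, by rw [mem_preimage, ← e]; exact hseg x hx (i + 1) hi⟩
    rw [e]
    exact (indicator_of_mem hm (fun x => ENNReal.ofReal |u (x + w) - u x|)).ge
  have hsum : Measurable fun x : EuclideanSpace ℝ (Fin d) =>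
      ∑ i ∈ Finset.range (2 ^ l), g (x + (i : ℝ) • w) :=
    Finset.measurable_fun_sum _ fun i _ => hg.comp (measurable_id.add_const _)
  calc _ ≤ ∫⁻ x in S, ∑ i ∈ Finset.range (2 ^ l), g (x + (i : ℝ) • w) :=
        setLIntegral_mono hsum hpt
    _ ≤ ∫⁻ x, ∑ i ∈ Finset.range (2 ^ l), g (x + (i : ℝ) • w) := setLIntegral_le_lintegral _ _
    _ = ∑ i ∈ Finset.range (2 ^ l), ∫⁻ x, g (x + (i : ℝ) • w) :=
        lintegral_finsetSum _ fun i _ => hg.comp (measurable_id.add_const _)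
    _ = ∑ i ∈ Finset.range (2 ^ l), ∫⁻ x, g x := by
        refine Finset.sum_congr rfl fun i _ => ?_
        exact lintegral_add_right_eq_self g _
    _ = _ := by
        rw [Finset.sum_const, Finset.card_range, nsmul_eq_mul, lintegral_indicator hZm]
        push_cast
        rfl

lemma measurable_incrementNorm (hu : Measurable u) (hZ : MeasurableSet Z) :
    Measurable (incrementNorm Z u) := by
  have h : incrementNorm Z u = fun v => ∫⁻ x, (Z ∩ (fun x => x + v) ⁻¹' Z).indicator
      (fun x => ENNReal.ofReal |u (x + v) - u x|) x := by
    funext v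
    rw [lintegral_indicator (measurableSet_inter_translate hZ v)]
    rfl
  rw [h]
  refine Measurable.lintegral_prod_right'
    (f := fun q : EuclideanSpace ℝ (Fin d) × EuclideanSpace ℝ (Fin d) =>
      (Z ∩ (fun x => x + q.1) ⁻¹' Z).indicator
        (fun x => ENNReal.ofReal |u (x + q.1) - u x|) q.2) ?_
  have h2 : (fun q : EuclideanSpace ℝ (Fin d) × EuclideanSpace ℝ (Fin d) =>
      (Z ∩ (fun x => x + q.1) ⁻¹' Z).indicator
        (fun x => ENNReal.ofReal |u (x + q.1) - u x|) q.2) =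
      (Prod.snd ⁻¹' Z ∩ (fun q : EuclideanSpace ℝ (Fin d) × EuclideanSpace ℝ (Fin d) =>
        q.2 + q.1) ⁻¹' Z).indicator (fun q => ENNReal.ofReal |u (q.2 + q.1) - u q.2|) := by
    funext q
    by_cases h3 : q.2 ∈ Z <;> by_cases h4 : q.2 + q.1 ∈ Z <;> simp [h3, h4]
  rw [h2]
  have ha : Measurable fun q : EuclideanSpace ℝ (Fin d) × EuclideanSpace ℝ (Fin d) =>
    q.2 + q.1 := measurable_snd.add measurable_fst
  exact ((((hu.comp ha).sub (hu.comp measurable_snd)).abs).ennreal_ofReal).indicator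
    ((measurable_snd hZ).inter (ha hZ))

lemma incrementNorm_le (hs : 0 ≤ s) (hZ : MeasurableSet Z)
    {v : EuclideanSpace ℝ (Fin d)} (hv : 0 < ‖v‖) {M : ℝ} (hM : ‖v‖ ≤ M) :
    incrementNorm Z u v ≤
      ENNReal.ofReal (M ^ ((d : ℝ) + s)) * ∫⁻ x, gagliardoKernel s Z u x (x + v) := by
  unfold incrementNorm
  rw [← lintegral_indicator (measurableSet_inter_translate hZ v),
    ← lintegral_const_mul' _ _ ENNReal.ofReal_ne_top]
  refine lintegral_mono fun x => ?_
  by_cases hx : x ∈ Z ∩ (fun x => x + v) ⁻¹' Z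
  · rw [indicator_of_mem hx]
    have h2 : x + v ∈ Z := hx.2
    simp only [gagliardoKernel, indicator_of_mem hx.1, indicator_of_mem h2]
    have hp : 0 < ‖v‖ ^ ((d : ℝ) + s) := Real.rpow_pos_of_pos hv _
    have hle : ‖v‖ ^ ((d : ℝ) + s) ≤ M ^ ((d : ℝ) + s) :=
      Real.rpow_le_rpow hv.le hM (by positivity)
    rw [← ENNReal.ofReal_mul (hp.le.trans hle)]
    refine ENNReal.ofReal_le_ofReal ?_
    have e : ‖x - (x + v)‖ = ‖v‖ := by rw [sub_add_cancel_left, norm_neg]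
    rw [e, abs_sub_comm, mul_div_assoc', le_div_iff₀ hp, mul_comm]
    exact mul_le_mul_of_nonneg_right hle (abs_nonneg _)
  · rw [indicator_of_notMem hx]
    exact zero_le

lemma one_sub_two_rpow_le {s : ℝ} (hs : s ≤ 1) : 1 - (2 : ℝ) ^ (s - 1) ≤ 1 - s := by
  have h := Real.add_one_le_exp (Real.log 2 * (s - 1))
  rw [Real.rpow_def_of_pos (by norm_num)]
  nlinarith [Real.log_two_lt_d9]

/-- Increments of `u` along the vectors of a ball are controlled by `1 - s` times the seminorm on a
set `Z` that contains all the segments involved. The factor `1 - s` comes from subdividing every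
segment into `2 ^ l` equal parts: each `l` gives the same bound up to the factor `2^{-l(1-s)}`, for
disjoint parts of the double integral, and these factors have the sum `1 / (1 - 2^{s-1})`. -/
lemma lintegral_ball_increment_le (hs0 : 0 ≤ s) (hs : s < 1) (hu : Measurable u)
    (hZ : MeasurableSet Z) {p : EuclideanSpace ℝ (Fin d)} {ρ : ℝ} (hp : 0 < ‖p‖)
    (hρ : 3 * ρ ≤ ‖p‖)
    (h : ∀ x ∈ S, ∀ v ∈ Metric.ball p ρ, ∀ θ ∈ Icc (0 : ℝ) 1, x + θ • v ∈ Z) :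
    ∫⁻ v in Metric.ball p ρ, ∫⁻ x in S, ENNReal.ofReal |u (x + v) - u x| ≤
      ENNReal.ofReal ((2 * ‖p‖) ^ ((d : ℝ) + s) * (1 - s)) * gagliardo s Z u := by
  set Q := ∫⁻ v in Metric.ball p ρ, ∫⁻ x in S, ENNReal.ofReal |u (x + v) - u x| with hQ
  let A : ℕ → Set (EuclideanSpace ℝ (Fin d)) := fun l => (fun v => (2 : ℝ) ^ l • v) ⁻¹' Metric.ball p ρ
  have hA : ∀ l, MeasurableSet (A l) := fun l => measurable_const_smul _ measurableSet_ball
  have hnorm : ∀ l, ∀ v ∈ A l, 2 / 3 * ‖p‖ < 2 ^ l * ‖v‖ ∧ 2 ^ l * ‖v‖ < 4 / 3 * ‖p‖ := by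
    intro l v hv
    have hv : ‖(2 : ℝ) ^ l • v - p‖ < ρ := mem_ball_iff_norm.1 hv
    have e : ‖(2 : ℝ) ^ l • v‖ = 2 ^ l * ‖v‖ := by
      rw [norm_smul, Real.norm_of_nonneg (by positivity)]
    have h1 := abs_le.1 (abs_norm_sub_norm_le ((2 : ℝ) ^ l • v) p)
    rw [e] at h1
    constructor <;> linarith [h1.1, h1.2]
  have hdisj : Pairwise (Function.onFun Disjoint A) := by
    have : ∀ l l' : ℕ, l < l' → Disjoint (A l) (A l') := by
      intro l l' hl
      refine disjoint_left.2 fun v h1 h2 => ?_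
      have h1 := (hnorm l v h1).1
      have h2 := (hnorm l' v h2).2
      have h3 : (2 : ℝ) ^ (l + 1) ≤ 2 ^ l' := pow_le_pow_right₀ (by norm_num) hl
      have h4 := mul_le_mul_of_nonneg_right h3 (norm_nonneg v)
      rw [pow_succ] at h4
      linarith
    intro l l' hne
    rcases lt_or_gt_of_ne hne with hl | hl
    · exact this l l' hl
    · exact (this l' l hl).symm
  let K : EuclideanSpace ℝ (Fin d) → ENNReal := fun v => ∫⁻ x, gagliardoKernel s Z u x (x + v)
  have hH := measurable_incrementNorm hu hZ
  have hlevel : ∀ l : ℕ, ENNReal.ofReal (((2 : ℝ) ^ (s - 1)) ^ l) * Q ≤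
      ENNReal.ofReal ((2 * ‖p‖) ^ ((d : ℝ) + s)) * ∫⁻ v in A l, K v := by
    intro l
    have h2l : (0 : ℝ) < 2 ^ l := by positivity
    have h1 : Q ≤ 2 ^ l * (ENNReal.ofReal (((2 : ℝ) ^ l) ^ d) *
        (ENNReal.ofReal ((2 * ‖p‖ * (1 / 2) ^ l) ^ ((d : ℝ) + s)) * ∫⁻ v in A l, K v)) := by
      calc Q ≤ ∫⁻ v in Metric.ball p ρ, 2 ^ l * incrementNorm Z u ((1 / 2 : ℝ) ^ l • v) := by
            refine setLIntegral_mono ((hH.comp (measurable_const_smul _)).const_mul _) ?_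
            exact fun v hv => lintegral_increment_le hu hZ (fun x hx => h x hx v hv) l
        _ = 2 ^ l * ∫⁻ v in Metric.ball p ρ, incrementNorm Z u ((1 / 2 : ℝ) ^ l • v) :=
            lintegral_const_mul _ (hH.comp (measurable_const_smul _))
        _ = 2 ^ l * ∫⁻ v, (A l).indicator (incrementNorm Z u) ((1 / 2 : ℝ) ^ l • v) := by
            rw [← lintegral_indicator measurableSet_ball]
            congr 1
            refine lintegral_congr fun v => ?_
            have e : (2 : ℝ) ^ l • (1 / 2 : ℝ) ^ l • v = v := by
              rw [smul_smul, ← mul_pow]; norm_num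
            have e' : (1 / 2 : ℝ) ^ l • v ∈ A l ↔ v ∈ Metric.ball p ρ := by
              simp only [A, mem_preimage, e]
            by_cases hv : v ∈ Metric.ball p ρ
            · rw [indicator_of_mem hv, indicator_of_mem (e'.2 hv)]
            · rw [indicator_of_notMem hv, indicator_of_notMem (fun hv' => hv (e'.1 hv'))]
        _ = 2 ^ l * (ENNReal.ofReal (((2 : ℝ) ^ l) ^ d) * ∫⁻ v in A l, incrementNorm Z u v) := by
            rw [lintegral_comp_smul _ (by positivity) (hH.indicator (hA l)),
              lintegral_indicator (hA l)]
            congr 3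
            rw [one_div, inv_pow, inv_pow, inv_inv]
        _ ≤ _ := by
            gcongr
            rw [← lintegral_const_mul' _ _ ENNReal.ofReal_ne_top]
            refine setLIntegral_mono' (hA l) fun v hv => ?_
            obtain ⟨ha, hb⟩ := hnorm l v hv
            refine incrementNorm_le hs0 hZ ?_ ?_
            · by_contra h0
              have : ‖v‖ = 0 := le_antisymm (not_lt.1 h0) (norm_nonneg v)
              rw [this] at ha
              linarith
            · rw [one_div, inv_pow, ← div_eq_mul_inv, le_div_iff₀ h2l]
              linarith
    have h2 : (2 : ENNReal) ^ l = ENNReal.ofReal (2 ^ l) := by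
      rw [ENNReal.ofReal_pow (by norm_num)]; norm_num
    rw [h2, ← mul_assoc, ← mul_assoc, ← ENNReal.ofReal_mul (by positivity),
      ← ENNReal.ofReal_mul (by positivity)] at h1
    refine (mul_le_mul_right h1 _).trans ?_
    rw [← mul_assoc, ← ENNReal.ofReal_mul (by positivity)]
    refine le_of_eq ?_
    congr 2
    have e1 : ((1 / 2 : ℝ) ^ l) ^ ((d : ℝ) + s) = (((2 : ℝ) ^ l) ^ ((d : ℝ) + s))⁻¹ := by
      rw [one_div, inv_pow, Real.inv_rpow h2l.le]
    have e2 : ((2 : ℝ) ^ (s - 1)) ^ l = ((2 : ℝ) ^ l) ^ s / 2 ^ l := by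
      rw [← Real.rpow_natCast, ← Real.rpow_natCast, ← Real.rpow_mul (by norm_num),
        ← Real.rpow_mul (by norm_num), ← Real.rpow_sub (by norm_num)]
      ring_nf
    rw [Real.mul_rpow (by positivity) (by positivity), e1, e2, Real.rpow_add h2l,
      Real.rpow_natCast]
    have := (Real.rpow_pos_of_pos h2l s).ne'
    field_simp
  have hq0 : 0 < (2 : ℝ) ^ (s - 1) := by positivity
  have hq1 : (2 : ℝ) ^ (s - 1) < 1 := Real.rpow_lt_one_of_one_lt_of_neg (by norm_num) (by linarith)
  have hsum : ENNReal.ofReal ((1 - s)⁻¹) * Q ≤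
      ENNReal.ofReal ((2 * ‖p‖) ^ ((d : ℝ) + s)) * gagliardo s Z u := by
    calc ENNReal.ofReal ((1 - s)⁻¹) * Q
        ≤ ENNReal.ofReal (∑' l : ℕ, ((2 : ℝ) ^ (s - 1)) ^ l) * Q := by
          rw [tsum_geometric_of_lt_one hq0.le hq1]
          exact mul_le_mul_left (ENNReal.ofReal_le_ofReal
            (inv_anti₀ (by linarith) (one_sub_two_rpow_le hs.le))) _
      _ = ∑' l : ℕ, ENNReal.ofReal (((2 : ℝ) ^ (s - 1)) ^ l) * Q := by
          rw [ENNReal.ofReal_tsum_of_nonneg (fun l => by positivity)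
            (summable_geometric_of_lt_one hq0.le hq1), ENNReal.tsum_mul_right]
      _ ≤ ∑' l : ℕ, ENNReal.ofReal ((2 * ‖p‖) ^ ((d : ℝ) + s)) * ∫⁻ v in A l, K v :=
          ENNReal.tsum_le_tsum hlevel
      _ = ENNReal.ofReal ((2 * ‖p‖) ^ ((d : ℝ) + s)) * ∫⁻ v in ⋃ l, A l, K v := by
          rw [ENNReal.tsum_mul_left, lintegral_iUnion hA hdisj]
      _ ≤ _ := by
          gcongr
          exact (setLIntegral_le_lintegral _ _).trans (lintegral_gagliardoKernel_add hu hZ).le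
  calc Q = ENNReal.ofReal (1 - s) * (ENNReal.ofReal ((1 - s)⁻¹) * Q) := by
        rw [← mul_assoc, ← ENNReal.ofReal_mul (by linarith), mul_inv_cancel₀ (by linarith)]
        simp
    _ ≤ ENNReal.ofReal (1 - s) *
        (ENNReal.ofReal ((2 * ‖p‖) ^ ((d : ℝ) + s)) * gagliardo s Z u) := by gcongr
    _ = _ := by
        rw [← mul_assoc, ← ENNReal.ofReal_mul (by linarith), mul_comm (1 - s)]

end Segments

/-! ### Local graph charts -/

section Charts

variable {d : ℕ}

/-- A coordinate-free local graph representation of `Ω` near `x₀`: inside the ball of radius `r`,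
`Ω` is the set where the height `h` above the graph is positive. The height is `K`-Lipschitz and
grows with unit speed in the vertical direction `e`; the normalisation `1 ≤ K` is for
convenience. -/
structure IsGraphChart (Ω : Set (EuclideanSpace ℝ (Fin d))) (x₀ e : EuclideanSpace ℝ (Fin d))
    (h : EuclideanSpace ℝ (Fin d) → ℝ) (K r : ℝ) : Prop where
  norm_e : ‖e‖ = 1
  one_le : 1 ≤ K
  r_pos : 0 < r
  lip : ∀ x y, |h x - h y| ≤ K * ‖x - y‖
  add_smul : ∀ x (τ : ℝ), h (x + τ • e) = h x + τ
  mem_iff : ∀ x ∈ Metric.ball x₀ r, x ∈ Ω ↔ 0 < h x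

lemma norm_initCoords_le {n : ℕ} (ξ : EuclideanSpace ℝ (Fin (n + 1))) :
    ‖initCoords ξ‖ ≤ ‖ξ‖ := by
  rw [EuclideanSpace.norm_eq, EuclideanSpace.norm_eq, Fin.sum_univ_castSucc]
  refine Real.sqrt_le_sqrt ?_
  have : 0 ≤ ‖ξ (Fin.last n)‖ ^ 2 := by positivity
  simpa [initCoords] using this

lemma IsBoundedLipschitzDomain.exists_isGraphChart {n : ℕ}
    {Ω : Set (EuclideanSpace ℝ (Fin (n + 1)))} (hΩ : IsBoundedLipschitzDomain Ω)
    {x₀ : EuclideanSpace ℝ (Fin (n + 1))} (hx₀ : x₀ ∈ frontier Ω) :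
    ∃ e h K r, IsGraphChart Ω x₀ e h K r := by
  obtain ⟨r, hr, T, φ, ⟨K, hK⟩, hT⟩ := hΩ.exists_graph x₀ hx₀
  let A := T.toRealAffineIsometryEquiv
  have hA : ∀ x, A x = T x := fun x => by simp [A]
  let b : EuclideanSpace ℝ (Fin (n + 1)) := EuclideanSpace.single (Fin.last n) 1
  let e := A.linearIsometryEquiv.symm b
  have hTe : ∀ x (τ : ℝ), T (x + τ • e) = T x + τ • b := by
    intro x τ
    rw [← hA, ← hA, add_comm x, ← vadd_eq_add (τ • e) x, AffineIsometryEquiv.map_vadd]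
    simp [e, add_comm]
  refine ⟨e, fun x => T x (Fin.last n) - φ (initCoords (T x)), 1 + K, r, ?_, ?_, hr, ?_, ?_, ?_⟩
  · simp [e, b]
  · linarith [K.2]
  · intro x y
    have h1 : |T x (Fin.last n) - T y (Fin.last n)| ≤ ‖x - y‖ := by
      have := PiLp.norm_apply_le (T x - T y) (Fin.last n)
      rw [← dist_eq_norm, T.dist_eq, dist_eq_norm] at this
      simpa using this
    have h2 : |φ (initCoords (T x)) - φ (initCoords (T y))| ≤ K * ‖x - y‖ := by
      have h3 := hK.dist_le_mul (initCoords (T x)) (initCoords (T y))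
      rw [Real.dist_eq] at h3
      refine h3.trans (mul_le_mul_of_nonneg_left ?_ K.2)
      have h4 : initCoords (T x) - initCoords (T y) = initCoords (T x - T y) := by
        ext i; simp [initCoords]
      rw [dist_eq_norm, h4, ← dist_eq_norm x, ← T.dist_eq, dist_eq_norm]
      exact norm_initCoords_le _
    calc _ = |(T x (Fin.last n) - T y (Fin.last n)) -
          (φ (initCoords (T x)) - φ (initCoords (T y)))| := by ring_nf
      _ ≤ _ := abs_sub _ _
      _ ≤ _ := by linarith
  · intro x τ
    have h1 : initCoords (T x + τ • b) = initCoords (T x) := by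
      ext i
      simp [initCoords, b]
    simp only [hTe, h1]
    simp [b]
    ring
  · intro x hx
    have h1 : T x ∈ Metric.ball (T x₀) r := by
      rw [Metric.mem_ball, T.dist_eq]; exact hx
    have h2 : T x ∈ T '' Ω ↔ x ∈ Ω := T.injective.mem_set_image
    have h3 : T x ∈ (T '' Ω) ∩ Metric.ball (T x₀) r ↔
      T x ∈ {ξ | φ (initCoords ξ) < ξ (Fin.last n)} ∩ Metric.ball (T x₀) r := by rw [hT]
    simp only [mem_inter_iff, h1, and_true, h2, mem_ofPred_eq] at h3
    rw [h3, sub_pos]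

/-- The part of a chart's domain over the base ball of radius `r / 4` (measured on the graph) at
heights in `I`. -/
def slab (x₀ e : EuclideanSpace ℝ (Fin d)) (h : EuclideanSpace ℝ (Fin d) → ℝ) (r : ℝ)
    (I : Set ℝ) : Set (EuclideanSpace ℝ (Fin d)) :=
  {x | ‖x - h x • e - x₀‖ < r / 4 ∧ h x ∈ I}

variable {Ω : Set (EuclideanSpace ℝ (Fin d))} {x₀ e : EuclideanSpace ℝ (Fin d)}
  {h : EuclideanSpace ℝ (Fin d) → ℝ} {K r : ℝ}

lemma setLIntegral_comp_add_right (S : Set (EuclideanSpace ℝ (Fin d)))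
    (a : EuclideanSpace ℝ (Fin d)) (f : EuclideanSpace ℝ (Fin d) → ENNReal) :
    ∫⁻ x in S, f (x + a) = ∫⁻ x in (fun y => y - a) ⁻¹' S, f x := by
  rw [← (measurePreserving_add_right volume a).setLIntegral_comp_preimage_emb
    (measurableEmbedding_addRight a) f ((fun y => y - a) ⁻¹' S), ← preimage_comp]
  have : (fun y => y - a) ∘ (· + a) = id := by
    funext x; simp
  rw [this, preimage_id]

lemma translate_slab (c : IsGraphChart Ω x₀ e h K r) (τ α β : ℝ) :
    (fun y => y - τ • e) ⁻¹' slab x₀ e h r (Ioc α β) = slab x₀ e h r (Ioc (α + τ) (β + τ)) := by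
  ext y
  have h1 : h (y - τ • e) = h y - τ := by
    rw [sub_eq_add_neg, ← neg_smul, c.add_smul, sub_eq_add_neg]
  have h2 : y - τ • e - (h y - τ) • e = y - h y • e := by
    rw [sub_smul]; abel
  simp only [slab, mem_preimage, mem_ofPred_eq, h1, h2, mem_Ioc, lt_sub_iff_add_lt,
    sub_le_iff_le_add]

namespace IsGraphChart

lemma K_pos (c : IsGraphChart Ω x₀ e h K r) : 0 < K := by linarith [c.one_le]

lemma continuous (c : IsGraphChart Ω x₀ e h K r) : Continuous h := by
  have : LipschitzWith (Real.toNNReal K) h := LipschitzWith.of_dist_le_mul fun x y => by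
    rw [Real.dist_eq, dist_eq_norm, Real.coe_toNNReal _ c.K_pos.le]
    exact c.lip x y
  exact this.continuous

lemma measurableSet_slab (c : IsGraphChart Ω x₀ e h K r) {I : Set ℝ} (hI : MeasurableSet I) :
    MeasurableSet (slab x₀ e h r I) := by
  have h1 : Continuous fun x => ‖x - h x • e - x₀‖ :=
    ((continuous_id.sub (c.continuous.smul continuous_const)).sub continuous_const).norm
  exact (measurableSet_lt h1.measurable measurable_const).inter (c.continuous.measurable hI)

lemma norm_smul_e (c : IsGraphChart Ω x₀ e h K r) (τ : ℝ) : ‖τ • e‖ = |τ| := by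
  rw [norm_smul, c.norm_e, mul_one, Real.norm_eq_abs]

lemma norm_sub_lt_of_mem_slab (c : IsGraphChart Ω x₀ e h K r) {I : Set ℝ}
    {x : EuclideanSpace ℝ (Fin d)} (hx : x ∈ slab x₀ e h r I) : ‖x - x₀‖ < r / 4 + |h x| := by
  have h1 : x - x₀ = (x - h x • e - x₀) + h x • e := by abel
  rw [h1, ← c.norm_smul_e (h x)]
  exact (norm_add_le _ _).trans_lt (by linarith [hx.1])

lemma mem_of_norm_lt (c : IsGraphChart Ω x₀ e h K r) {x : EuclideanSpace ℝ (Fin d)}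
    (hx : ‖x - x₀‖ < r) (h0 : 0 < h x) : x ∈ Ω :=
  (c.mem_iff x (mem_ball_iff_norm.2 hx)).2 h0

lemma bdist_le (c : IsGraphChart Ω x₀ e h K r) (hΩ : IsOpen Ω) {x : EuclideanSpace ℝ (Fin d)}
    (hx : ‖x - h x • e - x₀‖ < r) (h0 : 0 ≤ h x) : bdist Ω x ≤ h x := by
  set b := x - h x • e with hb
  have hb0 : h b = 0 := by
    rw [hb, sub_eq_add_neg, ← neg_smul, c.add_smul, add_neg_cancel]
  have hball : b ∈ Metric.ball x₀ r := mem_ball_iff_norm.2 hx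
  have hbΩ : b ∉ Ω := fun hbm => by
    have := (c.mem_iff b hball).1 hbm
    linarith
  have hcl : b ∈ closure Ω := by
    have ht : Tendsto (fun ε : ℝ => b + ε • e) (𝓝[>] 0) (𝓝 b) := by
      have : Continuous fun ε : ℝ => b + ε • e := by fun_prop
      have h2 := this.tendsto 0
      simp only [zero_smul, add_zero] at h2
      exact h2.mono_left nhdsWithin_le_nhds
    refine mem_closure_of_tendsto ht ?_
    filter_upwards [ht.eventually (Metric.isOpen_ball.mem_nhds hball), self_mem_nhdsWithin]
      with ε h1 h2
    rw [c.mem_iff _ h1, c.add_smul, hb0, zero_add]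
    exact h2
  have hfr : b ∈ frontier Ω := ⟨hcl, by rwa [hΩ.interior_eq]⟩
  refine (Metric.infDist_le_dist_of_mem hfr).trans ?_
  have : x - b = h x • e := by rw [hb]; abel
  rw [dist_eq_norm, this, c.norm_smul_e, abs_of_nonneg h0]

lemma le_bdist (c : IsGraphChart Ω x₀ e h K r) (hΩ : IsOpen Ω) (hx₀ : x₀ ∈ frontier Ω)
    {x : EuclideanSpace ℝ (Fin d)} (hx : ‖x - x₀‖ ≤ r / 2) (hr : h x ≤ r / 2) :
    h x ≤ K * bdist Ω x := by
  rw [← div_le_iff₀' c.K_pos]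
  refine (Metric.le_infDist ⟨x₀, hx₀⟩).2 fun y hy => ?_
  rw [div_le_iff₀' c.K_pos, dist_eq_norm]
  by_cases hyb : y ∈ Metric.ball x₀ r
  · have hyΩ : y ∉ Ω := by
      have := hy.2
      rwa [hΩ.interior_eq] at this
    have h1 : h y ≤ 0 := not_lt.1 fun h0 => hyΩ ((c.mem_iff y hyb).2 h0)
    linarith [(abs_le.1 (c.lip x y)).2]
  · have h1 : r ≤ ‖y - x₀‖ := not_lt.1 fun h0 => hyb (mem_ball_iff_norm.2 h0)
    have h2 : ‖y - x₀‖ ≤ ‖x - y‖ + ‖x - x₀‖ := by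
      rw [norm_sub_rev x y, ← sub_add_sub_cancel y x x₀]; exact norm_add_le _ _
    nlinarith [c.one_le, norm_nonneg (x - y)]

/-- Vectors close to the vertical direction point upwards. -/
lemma height_add (c : IsGraphChart Ω x₀ e h K r) {τ σ θ : ℝ} (hτ : 0 < τ) (hσ : τ ≤ σ)
    (hθ : θ ∈ Icc (0 : ℝ) 1) (x : EuclideanSpace ℝ (Fin d))
    {v : EuclideanSpace ℝ (Fin d)} (hv : v ∈ Metric.ball (σ • e) (τ / (4 * K))) :
    h x ≤ h (x + θ • v) ∧ h (x + θ • v) ≤ h x + σ + τ / 4 ∧ ‖θ • v‖ ≤ σ + τ / 4 := by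
  have hK := c.K_pos
  have hv : ‖v - σ • e‖ < τ / (4 * K) := mem_ball_iff_norm.1 hv
  rw [lt_div_iff₀ (by positivity)] at hv
  have e1 : x + θ • v = (x + θ • (v - σ • e)) + (θ * σ) • e := by
    rw [smul_sub, smul_smul]; abel
  have h1 := c.lip (x + θ • (v - σ • e)) x
  rw [add_sub_cancel_left, norm_smul, Real.norm_of_nonneg hθ.1] at h1
  have h2 := abs_le.1 h1
  have h3 : h (x + θ • v) = h (x + θ • (v - σ • e)) + θ * σ := by rw [e1, c.add_smul]
  have h4 : K * (θ * ‖v - σ • e‖) ≤ θ * (τ / 4) := by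
    have := mul_le_mul_of_nonneg_left hv.le hθ.1
    linarith
  have h5 : θ * τ ≤ θ * σ := mul_le_mul_of_nonneg_left hσ hθ.1
  have h6 : θ * τ ≤ 1 * τ := mul_le_mul_of_nonneg_right hθ.2 hτ.le
  have h7 : θ * σ ≤ 1 * σ := mul_le_mul_of_nonneg_right hθ.2 (by linarith)
  have h8 : 0 ≤ θ * τ := mul_nonneg hθ.1 hτ.le
  refine ⟨by linarith [h2.1], by linarith [h2.2], ?_⟩
  have h9 : ‖v‖ ≤ ‖v - σ • e‖ + σ := by
    have := norm_add_le (v - σ • e) (σ • e)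
    rwa [sub_add_cancel, c.norm_smul_e, abs_of_nonneg (by linarith)] at this
  rw [norm_smul, Real.norm_of_nonneg hθ.1]
  have h10 : ‖v - σ • e‖ ≤ τ / 4 := by nlinarith [c.one_le, norm_nonneg (v - σ • e)]
  calc θ * ‖v‖ ≤ 1 * ‖v‖ := mul_le_mul_of_nonneg_right hθ.2 (norm_nonneg v)
    _ ≤ _ := by linarith

end IsGraphChart

/-- The constant in the bound for vertical increments. -/
noncomputable def incrementConst (d : ℕ) (K : ℝ) : ℝ :=
  2 * 4 ^ (d + 1) * (4 * K) ^ d / (volume (Metric.ball (0 : EuclideanSpace ℝ (Fin d)) 1)).toReal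

/-- Vertical increments of `u` are controlled by the seminorm. The points `x` and `x + τ e` are
compared with all points of a common ball above both of them. -/
lemma IsGraphChart.lintegral_vertical_increment_le (c : IsGraphChart Ω x₀ e h K r) {s : ℝ}
    (hs0 : 0 ≤ s) (hs : s < 1) {u : EuclideanSpace ℝ (Fin d) → ℝ} (hu : Measurable u)
    {S Z : Set (EuclideanSpace ℝ (Fin d))} (hZ : MeasurableSet Z) {τ : ℝ} (hτ : 0 < τ)
    (hSZ : ∀ x ∈ S, ∀ y, ‖y - x‖ ≤ 3 * τ → h x ≤ h y → h y ≤ h x + 3 * τ → y ∈ Z) :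
    ∫⁻ x in S, ENNReal.ofReal |u (x + τ • e) - u x| ≤
      ENNReal.ofReal (incrementConst d K * τ ^ s * (1 - s)) * gagliardo s Z u := by
  have hK := c.K_pos
  set ρ := τ / (4 * K) with hρ
  have hρ0 : 0 < ρ := by positivity
  have hρτ : 3 * ρ ≤ τ := by
    rw [hρ, mul_div_assoc', div_le_iff₀ (by positivity)]
    nlinarith [c.one_le]
  set G := gagliardo s Z u
  have hn1 : ‖τ • e‖ = τ := by rw [c.norm_smul_e, abs_of_pos hτ]
  have hn2 : ‖(2 * τ) • e‖ = 2 * τ := by rw [c.norm_smul_e, abs_of_pos (by linarith)]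
  have hQ1 := lintegral_ball_increment_le (S := S) hs0 hs hu hZ (p := (2 * τ) • e) (ρ := ρ)
    (by rw [hn2]; linarith) (by rw [hn2]; linarith) (by
      intro x hx v hv θ hθ
      obtain ⟨h1, h2, h3⟩ := c.height_add hτ (by linarith) hθ x hv
      refine hSZ x hx _ ?_ h1 (by linarith)
      rw [add_sub_cancel_left]
      linarith)
  have hQ2 := lintegral_ball_increment_le (S := (fun y => y - τ • e) ⁻¹' S) hs0 hs hu hZ
    (p := τ • e) (ρ := ρ) (by rw [hn1]; linarith) (by rw [hn1]; linarith) (by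
      intro x hx v hv θ hθ
      obtain ⟨h1, h2, h3⟩ := c.height_add hτ le_rfl hθ x hv
      have hx' : h x = h (x - τ • e) + τ := by
        rw [← c.add_smul, sub_add_cancel]
      refine hSZ _ hx _ ?_ (by linarith) (by linarith)
      have e1 : x + θ • v - (x - τ • e) = θ • v + τ • e := by abel
      rw [e1]
      refine (norm_add_le _ _).trans ?_
      rw [hn1]
      linarith)
  rw [hn2] at hQ1
  rw [hn1] at hQ2
  have hm1 : Measurable fun q : EuclideanSpace ℝ (Fin d) × EuclideanSpace ℝ (Fin d) =>
      ENNReal.ofReal |u (q.2 + q.1) - u q.2| :=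
    (((hu.comp (measurable_snd.add measurable_fst)).sub (hu.comp measurable_snd)).abs).ennreal_ofReal
  have hm2 : Measurable fun q : EuclideanSpace ℝ (Fin d) × EuclideanSpace ℝ (Fin d) =>
      ENNReal.ofReal |u (q.2 + q.1) - u (q.2 + τ • e)| :=
    (((hu.comp (measurable_snd.add measurable_fst)).sub
      (hu.comp (measurable_snd.add_const _))).abs).ennreal_ofReal
  have hshift : ∫⁻ v in Metric.ball ((2 * τ) • e) ρ, ∫⁻ x in S,
      ENNReal.ofReal |u (x + v) - u (x + τ • e)| =
      ∫⁻ v in Metric.ball (τ • e) ρ, ∫⁻ x in (fun y => y - τ • e) ⁻¹' S,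
        ENNReal.ofReal |u (x + v) - u x| := by
    have hb : Metric.ball ((2 * τ) • e) ρ = (fun y => y - τ • e) ⁻¹' Metric.ball (τ • e) ρ := by
      ext v
      simp only [mem_preimage, mem_ball_iff_norm, sub_sub, two_mul, _root_.add_smul]
    rw [hb, ← setLIntegral_comp_add_right]
    refine lintegral_congr fun v => ?_
    rw [← setLIntegral_comp_add_right]
    refine lintegral_congr fun x => ?_
    rw [add_comm v, add_assoc]
  have hvol : volume (Metric.ball ((2 * τ) • e) ρ) * ∫⁻ x in S, ENNReal.ofReal |u (x + τ • e) - u x|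
      ≤ ENNReal.ofReal (2 * (4 * τ) ^ ((d : ℝ) + s) * (1 - s)) * G := by
    calc _ = ∫⁻ v in Metric.ball ((2 * τ) • e) ρ, ∫⁻ x in S,
          ENNReal.ofReal |u (x + τ • e) - u x| := by rw [setLIntegral_const, mul_comm]
      _ ≤ ∫⁻ v in Metric.ball ((2 * τ) • e) ρ, ((∫⁻ x in S, ENNReal.ofReal |u (x + v) - u x|) +
          ∫⁻ x in S, ENNReal.ofReal |u (x + v) - u (x + τ • e)|) := by
          refine lintegral_mono fun v => ?_
          have hm3 : Measurable fun x => ENNReal.ofReal |u (x + v) - u x| :=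
            (((hu.comp (measurable_id.add_const v)).sub hu).abs).ennreal_ofReal
          rw [← lintegral_add_left hm3]
          refine lintegral_mono fun x => ?_
          dsimp only
          rw [← ENNReal.ofReal_add (abs_nonneg _) (abs_nonneg _)]
          refine ENNReal.ofReal_le_ofReal ?_
          have e1 : u (x + τ • e) - u x = (u (x + v) - u x) - (u (x + v) - u (x + τ • e)) := by ring
          rw [e1]
          exact abs_sub _ _
      _ = _ := lintegral_add_left (hm1.lintegral_prod_right') _
      _ ≤ ENNReal.ofReal ((2 * (2 * τ)) ^ ((d : ℝ) + s) * (1 - s)) * G +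
          ENNReal.ofReal ((2 * τ) ^ ((d : ℝ) + s) * (1 - s)) * G := by
          rw [hshift]
          exact add_le_add hQ1 hQ2
      _ ≤ _ := by
          rw [← add_mul, ← ENNReal.ofReal_add (mul_nonneg (by positivity) (by linarith))
            (mul_nonneg (by positivity) (by linarith))]
          gcongr
          have h1 : (2 * τ) ^ ((d : ℝ) + s) ≤ (4 * τ) ^ ((d : ℝ) + s) :=
            Real.rpow_le_rpow (by positivity) (by linarith) (by positivity)
          have h2 : 2 * (2 * τ) = 4 * τ := by ring
          rw [h2]
          nlinarith
  set ω := (volume (Metric.ball (0 : EuclideanSpace ℝ (Fin d)) 1)) with hω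
  have hω0 : 0 < ω.toReal := ENNReal.toReal_pos (Metric.measure_ball_pos _ _ one_pos).ne'
    measure_ball_lt_top.ne
  have hωr : ω = ENNReal.ofReal ω.toReal := (ENNReal.ofReal_toReal measure_ball_lt_top.ne).symm
  rw [Measure.addHaar_ball_of_pos _ _ hρ0, finrank_euclideanSpace_fin, ← hω, hωr,
    ← ENNReal.ofReal_mul (by positivity)] at hvol
  have hc0 : 0 < ρ ^ d * ω.toReal := by positivity
  calc _ = ENNReal.ofReal ((ρ ^ d * ω.toReal)⁻¹) * (ENNReal.ofReal (ρ ^ d * ω.toReal) *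
        ∫⁻ x in S, ENNReal.ofReal |u (x + τ • e) - u x|) := by
        rw [← mul_assoc, ← ENNReal.ofReal_mul (by positivity), inv_mul_cancel₀ hc0.ne']
        simp
    _ ≤ ENNReal.ofReal ((ρ ^ d * ω.toReal)⁻¹) *
        (ENNReal.ofReal (2 * (4 * τ) ^ ((d : ℝ) + s) * (1 - s)) * G) := by gcongr
    _ ≤ _ := by
        rw [← mul_assoc, ← ENNReal.ofReal_mul (by positivity)]
        refine mul_le_mul_left (ENNReal.ofReal_le_ofReal ?_) _
        rw [← mul_assoc]
        refine mul_le_mul_of_nonneg_right ?_ (by linarith)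
        have h4 : (4 : ℝ) ^ ((d : ℝ) + s) ≤ 4 ^ (d + 1) := by
          rw [← Real.rpow_natCast 4 (d + 1)]
          refine Real.rpow_le_rpow_of_exponent_le (by norm_num) ?_
          push_cast; linarith
        rw [Real.mul_rpow (by norm_num) hτ.le, Real.rpow_add hτ, Real.rpow_natCast]
        unfold incrementConst
        rw [← hω]
        have hts : 0 < τ ^ s := Real.rpow_pos_of_pos hτ s
        calc (ρ ^ d * ω.toReal)⁻¹ * (2 * ((4 : ℝ) ^ ((d : ℝ) + s) * (τ ^ d * τ ^ s)))
            ≤ (ρ ^ d * ω.toReal)⁻¹ * (2 * (4 ^ (d + 1) * (τ ^ d * τ ^ s))) := by gcongr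
          _ = _ := by
            rw [hρ, div_pow]
            field_simp

end Charts

/-! ### Dyadic slabs over a chart -/

section Slabs

variable {d : ℕ} {Ω : Set (EuclideanSpace ℝ (Fin d))} {x₀ e : EuclideanSpace ℝ (Fin d)}
  {h : EuclideanSpace ℝ (Fin d) → ℝ} {K r : ℝ}

lemma slab_Ioc_union {α β γ : ℝ} (h1 : α ≤ β) (h2 : β ≤ γ) :
    slab x₀ e h r (Ioc α γ) = slab x₀ e h r (Ioc α β) ∪ slab x₀ e h r (Ioc β γ) := by
  ext x
  simp only [slab, mem_ofPred_eq, mem_union, ← Ioc_union_Ioc_eq_Ioc h1 h2, and_or_left]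

lemma disjoint_slab {I J : Set ℝ} (hIJ : Disjoint I J) :
    Disjoint (slab x₀ e h r I) (slab x₀ e h r J) :=
  disjoint_left.2 fun _ h1 h2 => disjoint_left.1 hIJ h1.2 h2.2

lemma IsGraphChart.lintegral_slab_union (c : IsGraphChart Ω x₀ e h K r) {α β γ : ℝ} (h1 : α ≤ β)
    (h2 : β ≤ γ) (f : EuclideanSpace ℝ (Fin d) → ENNReal) :
    ∫⁻ x in slab x₀ e h r (Ioc α γ), f x =
      (∫⁻ x in slab x₀ e h r (Ioc α β), f x) + ∫⁻ x in slab x₀ e h r (Ioc β γ), f x := by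
  rw [slab_Ioc_union h1 h2]
  exact lintegral_union (c.measurableSet_slab measurableSet_Ioc)
    (disjoint_slab (Ioc_disjoint_Ioc_of_le le_rfl))

lemma IsGraphChart.lintegral_slab_comp_add (c : IsGraphChart Ω x₀ e h K r) (τ α β : ℝ)
    (f : EuclideanSpace ℝ (Fin d) → ENNReal) :
    ∫⁻ x in slab x₀ e h r (Ioc α β), f (x + τ • e) =
      ∫⁻ x in slab x₀ e h r (Ioc (α + τ) (β + τ)), f x := by
  rw [setLIntegral_comp_add_right, translate_slab c]

/-- A dyadic slab is the union of two vertical translates of the next one. -/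
lemma IsGraphChart.lintegral_slab_double (c : IsGraphChart Ω x₀ e h K r) {τ : ℝ} (hτ : 0 ≤ τ)
    (f : EuclideanSpace ℝ (Fin d) → ENNReal) :
    ∫⁻ x in slab x₀ e h r (Ioc (2 * τ) (4 * τ)), f x =
      (∫⁻ x in slab x₀ e h r (Ioc τ (2 * τ)), f (x + τ • e)) +
        ∫⁻ x in slab x₀ e h r (Ioc τ (2 * τ)), f (x + (2 * τ) • e) := by
  rw [c.lintegral_slab_comp_add, c.lintegral_slab_comp_add,
    c.lintegral_slab_union (β := 3 * τ) (by linarith) (by linarith)]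
  ring_nf

lemma IsGraphChart.two_mul_lintegral_slab_le (c : IsGraphChart Ω x₀ e h K r) {τ : ℝ} (hτ : 0 ≤ τ)
    {u : EuclideanSpace ℝ (Fin d) → ℝ} (hu : Measurable u) :
    2 * ∫⁻ x in slab x₀ e h r (Ioc τ (2 * τ)), ENNReal.ofReal |u x| ≤
      (∫⁻ x in slab x₀ e h r (Ioc (2 * τ) (4 * τ)), ENNReal.ofReal |u x|) +
        2 * ∫⁻ x in slab x₀ e h r (Ioc τ (3 * τ)), ENNReal.ofReal |u (x + τ • e) - u x| := by
  have hm : ∀ a : EuclideanSpace ℝ (Fin d), Measurable fun x => ENNReal.ofReal |u (x + a)| :=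
    fun a => ((hu.comp (measurable_id.add_const a)).abs).ennreal_ofReal
  set S := slab x₀ e h r (Ioc τ (2 * τ)) with hS
  have h1 : ∫⁻ x in S, ENNReal.ofReal |u x| ≤ (∫⁻ x in S, ENNReal.ofReal |u (x + τ • e)|) +
      ∫⁻ x in S, ENNReal.ofReal |u (x + τ • e) - u x| := by
    rw [← lintegral_add_left (hm _)]
    refine lintegral_mono fun x => ?_
    dsimp only
    rw [← ENNReal.ofReal_add (abs_nonneg _) (abs_nonneg _)]
    refine ENNReal.ofReal_le_ofReal ?_
    have e1 : u x = u (x + τ • e) - (u (x + τ • e) - u x) := by ring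
    conv_lhs => rw [e1]
    exact abs_sub _ _
  have h2 : ∫⁻ x in S, ENNReal.ofReal |u (x + τ • e)| ≤
      (∫⁻ x in S, ENNReal.ofReal |u (x + (2 * τ) • e)|) +
      ∫⁻ x in S, ENNReal.ofReal |u (x + (2 * τ) • e) - u (x + τ • e)| := by
    rw [← lintegral_add_left (hm _)]
    refine lintegral_mono fun x => ?_
    dsimp only
    rw [← ENNReal.ofReal_add (abs_nonneg _) (abs_nonneg _)]
    refine ENNReal.ofReal_le_ofReal ?_
    have e1 : u (x + τ • e) = u (x + (2 * τ) • e) - (u (x + (2 * τ) • e) - u (x + τ • e)) := by ring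
    conv_lhs => rw [e1]
    exact abs_sub _ _
  have h3 : ∫⁻ x in S, ENNReal.ofReal |u (x + (2 * τ) • e) - u (x + τ • e)| =
      ∫⁻ x in slab x₀ e h r (Ioc (2 * τ) (3 * τ)), ENNReal.ofReal |u (x + τ • e) - u x| := by
    have := c.lintegral_slab_comp_add τ τ (2 * τ) (fun x => ENNReal.ofReal |u (x + τ • e) - u x|)
    have e1 : ∀ x : EuclideanSpace ℝ (Fin d), x + (2 * τ) • e = x + τ • e + τ • e := fun x => by
      rw [two_mul, _root_.add_smul, add_assoc]
    simp only [e1]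
    rw [this]
    ring_nf
  rw [c.lintegral_slab_double hτ, c.lintegral_slab_union (α := τ) (β := 2 * τ) (γ := 3 * τ)
      (by linarith) (by linarith),
    ← h3, ← hS]
  set A := ∫⁻ x in S, ENNReal.ofReal |u x|
  set B := ∫⁻ x in S, ENNReal.ofReal |u (x + τ • e)|
  set B' := ∫⁻ x in S, ENNReal.ofReal |u (x + (2 * τ) • e)|
  set D := ∫⁻ x in S, ENNReal.ofReal |u (x + τ • e) - u x|
  set D' := ∫⁻ x in S, ENNReal.ofReal |u (x + (2 * τ) • e) - u (x + τ • e)|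
  calc 2 * A = A + A := two_mul A
    _ ≤ (B + D) + ((B' + D') + D) := add_le_add h1 (h1.trans (by gcongr))
    _ = (B + B') + (2 * D + D') := by ring
    _ ≤ (B + B') + (2 * D + 2 * D') := by
        gcongr
        exact le_mul_of_one_le_left zero_le (by norm_num)
    _ = _ := by ring

lemma pairwise_disjoint_dyadic {b : ℝ} (hb : 0 < b) :
    Pairwise (Function.onFun Disjoint fun j : ℕ => Ioc (b * (1 / 2) ^ j) (2 * (b * (1 / 2) ^ j))) := by
  have : ∀ j j' : ℕ, j < j' → Disjoint (Ioc (b * (1 / 2) ^ j) (2 * (b * (1 / 2) ^ j)))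
      (Ioc (b * (1 / 2 : ℝ) ^ j') (2 * (b * (1 / 2) ^ j'))) := by
    intro j j' hj
    refine disjoint_left.2 fun x h1 h2 => ?_
    have h3 : (1 / 2 : ℝ) ^ j' ≤ (1 / 2) ^ (j + 1) :=
      pow_le_pow_of_le_one (by norm_num) (by norm_num) hj
    have h4 := mul_le_mul_of_nonneg_left h3 hb.le
    rw [pow_succ] at h4
    linarith [h1.1, h2.2]
  intro j j' hne
  rcases lt_or_gt_of_ne hne with hl | hl
  · exact this j j' hl
  · exact (this j' j hl).symm

/-- The layer of `Ω` at heights between `τ` and `8 τ`. -/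
def layer (Ω : Set (EuclideanSpace ℝ (Fin d))) (h : EuclideanSpace ℝ (Fin d) → ℝ) (τ : ℝ) :
    Set (EuclideanSpace ℝ (Fin d)) :=
  Ω ∩ h ⁻¹' Ioc τ (8 * τ)

/-- The dyadic layers cover no point more than three times. -/
lemma tsum_gagliardo_layer_le (hΩ : MeasurableSet Ω) (hh : Measurable h) {b : ℝ} (hb : 0 < b)
    (s : ℝ) (u : EuclideanSpace ℝ (Fin d) → ℝ) :
    ∑' j : ℕ, gagliardo s (layer Ω h (b * (1 / 2) ^ j)) u ≤ 3 * gagliardo s Ω u := by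
  set F : EuclideanSpace ℝ (Fin d) → ENNReal := fun x =>
    ∫⁻ y in Ω, ENNReal.ofReal (|u x - u y| / ‖x - y‖ ^ ((d : ℝ) + s)) with hF
  have h1 : ∀ β : ℝ, 0 < β → ∑' j : ℕ,
      ∫⁻ x in Ω ∩ h ⁻¹' Ioc (β * (1 / 2) ^ j) (2 * (β * (1 / 2) ^ j)), F x ≤ gagliardo s Ω u := by
    intro β hβ
    rw [← lintegral_iUnion]
    · exact lintegral_mono_set (iUnion_subset fun j => inter_subset_left)
    · exact fun j => hΩ.inter (hh measurableSet_Ioc)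
    · intro j j' hne
      exact ((pairwise_disjoint_dyadic hβ hne).preimage h).mono inter_subset_right inter_subset_right
  have h2 : ∀ j : ℕ, gagliardo s (layer Ω h (b * (1 / 2) ^ j)) u ≤
      (∫⁻ x in Ω ∩ h ⁻¹' Ioc (b * (1 / 2) ^ j) (2 * (b * (1 / 2) ^ j)), F x) +
      (∫⁻ x in Ω ∩ h ⁻¹' Ioc (2 * b * (1 / 2) ^ j) (2 * (2 * b * (1 / 2) ^ j)), F x) +
      (∫⁻ x in Ω ∩ h ⁻¹' Ioc (4 * b * (1 / 2) ^ j) (2 * (4 * b * (1 / 2) ^ j)), F x) := by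
    intro j
    calc gagliardo s (layer Ω h (b * (1 / 2) ^ j)) u
        ≤ ∫⁻ x in layer Ω h (b * (1 / 2) ^ j), F x := by
          unfold gagliardo
          exact lintegral_mono fun x => lintegral_mono_set inter_subset_left
      _ ≤ ∫⁻ x in (Ω ∩ h ⁻¹' Ioc (b * (1 / 2) ^ j) (2 * (b * (1 / 2) ^ j)) ∪
            Ω ∩ h ⁻¹' Ioc (2 * b * (1 / 2) ^ j) (2 * (2 * b * (1 / 2) ^ j))) ∪
            Ω ∩ h ⁻¹' Ioc (4 * b * (1 / 2) ^ j) (2 * (4 * b * (1 / 2) ^ j)), F x := by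
          refine lintegral_mono_set fun x hx => ?_
          have hx2 : h x ∈ Ioc (b * (1 / 2) ^ j) (8 * (b * (1 / 2) ^ j)) := hx.2
          by_cases c1 : h x ≤ 2 * (b * (1 / 2) ^ j)
          · exact Or.inl (Or.inl ⟨hx.1, hx2.1, c1⟩)
          by_cases c2 : h x ≤ 4 * (b * (1 / 2) ^ j)
          · exact Or.inl (Or.inr ⟨hx.1, by linarith, by linarith⟩)
          · exact Or.inr ⟨hx.1, by linarith, by linarith [hx2.2]⟩
      _ ≤ _ := (lintegral_union_le _ _ _).trans (by gcongr; exact lintegral_union_le _ _ _)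
  calc _ ≤ _ := ENNReal.tsum_le_tsum h2
    _ ≤ gagliardo s Ω u + gagliardo s Ω u + gagliardo s Ω u := by
        rw [ENNReal.tsum_add, ENNReal.tsum_add]
        exact add_le_add (add_le_add (h1 b hb) (h1 (2 * b) (by linarith))) (h1 (4 * b) (by linarith))
    _ = _ := by ring

/-- The dyadic slabs over the base of a chart, from height `a` down to the graph. -/
def dyadicSlab (x₀ e : EuclideanSpace ℝ (Fin d)) (h : EuclideanSpace ℝ (Fin d) → ℝ) (r a : ℝ)
    (k : ℕ) : Set (EuclideanSpace ℝ (Fin d)) :=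
  slab x₀ e h r (Ioc (a * (1 / 2) ^ (k + 1)) (a * (1 / 2) ^ k))

lemma IsGraphChart.measurableSet_dyadicSlab (c : IsGraphChart Ω x₀ e h K r) (a : ℝ) (k : ℕ) :
    MeasurableSet (dyadicSlab x₀ e h r a k) :=
  c.measurableSet_slab measurableSet_Ioc

lemma dyadicSlab_bounds {a : ℝ} (ha : 0 < a) {k : ℕ} {x : EuclideanSpace ℝ (Fin d)}
    (hx : x ∈ dyadicSlab x₀ e h r a k) : 0 < h x ∧ h x ≤ a :=
  ⟨(by positivity : 0 < a * (1 / 2) ^ (k + 1)).trans hx.2.1, hx.2.2.trans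
    (mul_le_of_le_one_right ha.le (pow_le_one₀ (by norm_num) (by norm_num)))⟩

lemma IsGraphChart.dyadicSlab_subset (c : IsGraphChart Ω x₀ e h K r) {a : ℝ} (ha : 0 < a)
    (har : a ≤ r / 32) (k : ℕ) : dyadicSlab x₀ e h r a k ⊆ Ω := by
  intro x hx
  obtain ⟨h0, h1⟩ := dyadicSlab_bounds ha hx
  have h2 := c.norm_sub_lt_of_mem_slab hx
  rw [abs_of_pos h0] at h2
  exact c.mem_of_norm_lt (by linarith [c.r_pos]) h0

lemma IsGraphChart.bdist_bounds (c : IsGraphChart Ω x₀ e h K r) (hΩ : IsOpen Ω)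
    (hx₀ : x₀ ∈ frontier Ω) {a : ℝ} (ha : 0 < a) (har : a ≤ r / 32) {k : ℕ}
    {x : EuclideanSpace ℝ (Fin d)} (hx : x ∈ dyadicSlab x₀ e h r a k) :
    a / (2 * K) * (1 / 2) ^ k ≤ bdist Ω x ∧ bdist Ω x ≤ a * (1 / 2) ^ k := by
  obtain ⟨h0, h1⟩ := dyadicSlab_bounds ha hx
  have hr := c.r_pos
  have h2 := c.norm_sub_lt_of_mem_slab hx
  rw [abs_of_pos h0] at h2
  refine ⟨?_, (c.bdist_le hΩ (by linarith [hx.1]) h0.le).trans hx.2.2⟩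
  have h3 := c.le_bdist hΩ hx₀ (x := x) (by linarith) (by linarith)
  have h4 := hx.2.1
  have hK := c.K_pos
  rw [div_mul_eq_mul_div, div_le_iff₀ (by positivity)]
  rw [pow_succ] at h4
  linarith

/-- The rescaled mass of `|u|` on the dyadic slabs grows, from one slab to the next, by no more
than the seminorm over a layer. -/
lemma IsGraphChart.slab_mass_succ_le (c : IsGraphChart Ω x₀ e h K r) (hΩ : IsOpen Ω) {a : ℝ}
    (ha : 0 < a) (ha1 : a ≤ 1) (har : a ≤ r / 32) {s : ℝ} (hs0 : 0 ≤ s) (hs : s < 1)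
    {u : EuclideanSpace ℝ (Fin d) → ℝ} (hu : Measurable u) (k : ℕ) :
    ENNReal.ofReal (((2 : ℝ) ^ s) ^ (k + 1)) *
        (∫⁻ x in dyadicSlab x₀ e h r a (k + 1), ENNReal.ofReal |u x|) ≤
      ENNReal.ofReal (((2 : ℝ) ^ s) ^ k) *
        (∫⁻ x in dyadicSlab x₀ e h r a k, ENNReal.ofReal |u x|) +
      ENNReal.ofReal (incrementConst d K * (1 - s)) *
        gagliardo s (layer Ω h (a / 4 * (1 / 2) ^ k)) u := by
  set τ := a / 4 * (1 / 2) ^ k with hτd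
  have hτ : 0 < τ := by positivity
  have hτa : τ ≤ a / 4 :=
    mul_le_of_le_one_right (by positivity) (pow_le_one₀ (by norm_num) (by norm_num))
  have e1 : dyadicSlab x₀ e h r a (k + 1) = slab x₀ e h r (Ioc τ (2 * τ)) := by
    unfold dyadicSlab; congr 2 <;> rw [hτd] <;> ring
  have e2 : dyadicSlab x₀ e h r a k = slab x₀ e h r (Ioc (2 * τ) (4 * τ)) := by
    unfold dyadicSlab; congr 2 <;> rw [hτd] <;> ring
  have h1 := c.two_mul_lintegral_slab_le hτ.le hu
  have h2 := c.lintegral_vertical_increment_le hs0 hs hu (S := slab x₀ e h r (Ioc τ (3 * τ)))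
    (Z := layer Ω h τ) (hΩ.measurableSet.inter (c.continuous.measurable measurableSet_Ioc)) hτ (by
      intro x hx y hy hy1 hy2
      have hx2 := hx.2
      have h3 := c.norm_sub_lt_of_mem_slab hx
      rw [abs_of_pos (hτ.trans hx2.1)] at h3
      have h4 : ‖y - x₀‖ ≤ ‖y - x‖ + ‖x - x₀‖ := by
        rw [← sub_add_sub_cancel y x x₀]; exact norm_add_le _ _
      refine ⟨c.mem_of_norm_lt ?_ ?_, ?_, ?_⟩ <;> linarith [hx2.1, hx2.2, c.r_pos])
  rw [e1, e2]
  set A' := ∫⁻ x in slab x₀ e h r (Ioc τ (2 * τ)), ENNReal.ofReal |u x|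
  set A := ∫⁻ x in slab x₀ e h r (Ioc (2 * τ) (4 * τ)), ENNReal.ofReal |u x|
  set G := gagliardo s (layer Ω h τ) u
  have hC : 0 ≤ incrementConst d K := by
    have := c.K_pos
    unfold incrementConst; positivity
  have h2s : (0 : ℝ) < 2 ^ s := by positivity
  have h2s' : (2 : ℝ) ^ s ≤ 2 := by
    conv_rhs => rw [← Real.rpow_one 2]
    exact Real.rpow_le_rpow_of_exponent_le (by norm_num) hs.le
  have hhalf : ENNReal.ofReal (1 / 2) * 2 = 1 := by
    have : (2 : ENNReal) = ENNReal.ofReal 2 := by norm_num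
    rw [this, ← ENNReal.ofReal_mul (by norm_num)]; norm_num
  have h3 : A' ≤ ENNReal.ofReal (1 / 2) * A +
      ENNReal.ofReal (incrementConst d K * τ ^ s * (1 - s)) * G := by
    calc A' = ENNReal.ofReal (1 / 2) * (2 * A') := by rw [← mul_assoc, hhalf, one_mul]
      _ ≤ ENNReal.ofReal (1 / 2) * (A + 2 *
          (ENNReal.ofReal (incrementConst d K * τ ^ s * (1 - s)) * G)) := by
          exact mul_le_mul_right (h1.trans (add_le_add le_rfl (mul_le_mul_right h2 _))) _
      _ = _ := by rw [mul_add, ← mul_assoc (ENNReal.ofReal (1 / 2)) 2, hhalf, one_mul]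
  refine (mul_le_mul_right h3 _).trans ?_
  rw [mul_add, ← mul_assoc, ← mul_assoc, ← ENNReal.ofReal_mul (by positivity),
    ← ENNReal.ofReal_mul (by positivity)]
  refine add_le_add (mul_le_mul_left (ENNReal.ofReal_le_ofReal ?_) _)
    (mul_le_mul_left (ENNReal.ofReal_le_ofReal ?_) _)
  · rw [pow_succ]
    have : 0 < ((2 : ℝ) ^ s) ^ k := by positivity
    nlinarith
  · have e3 : ((2 : ℝ) ^ s) ^ (k + 1) * τ ^ s = (a / 2) ^ s := by
      rw [← Real.rpow_natCast, ← Real.rpow_mul (by norm_num), mul_comm s, Real.rpow_mul (by norm_num),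
        Real.rpow_natCast, ← Real.mul_rpow (by positivity) hτ.le]
      congr 1
      rw [hτd, one_div, inv_pow, pow_succ]
      field_simp
      ring
    have e4 : (a / 2) ^ s ≤ 1 := Real.rpow_le_one (by positivity) (by linarith) hs0
    calc _ = incrementConst d K * (1 - s) * (((2 : ℝ) ^ s) ^ (k + 1) * τ ^ s) := by ring
      _ ≤ _ := by
        rw [e3]
        exact mul_le_of_le_one_right (mul_nonneg hC (by linarith)) e4

lemma IsGraphChart.slab_mass_le (c : IsGraphChart Ω x₀ e h K r) (hΩ : IsOpen Ω) {a : ℝ}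
    (ha : 0 < a) (ha1 : a ≤ 1) (har : a ≤ r / 32) {s : ℝ} (hs0 : 0 ≤ s) (hs : s < 1)
    {u : EuclideanSpace ℝ (Fin d) → ℝ} (hu : Measurable u) (k : ℕ) :
    ENNReal.ofReal (((2 : ℝ) ^ s) ^ k) *
        (∫⁻ x in dyadicSlab x₀ e h r a k, ENNReal.ofReal |u x|) ≤
      (∫⁻ x in Ω, ENNReal.ofReal |u x|) +
        ENNReal.ofReal (incrementConst d K * (1 - s)) * (3 * gagliardo s Ω u) := by
  have h1 : ∀ k : ℕ, ENNReal.ofReal (((2 : ℝ) ^ s) ^ k) *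
        (∫⁻ x in dyadicSlab x₀ e h r a k, ENNReal.ofReal |u x|) ≤
      (∫⁻ x in Ω, ENNReal.ofReal |u x|) + ∑ j ∈ Finset.range k,
        ENNReal.ofReal (incrementConst d K * (1 - s)) *
          gagliardo s (layer Ω h (a / 4 * (1 / 2) ^ j)) u := by
    intro k
    induction k with
    | zero => simpa using lintegral_mono_set (c.dyadicSlab_subset ha har 0)
    | succ k ih =>
      rw [Finset.sum_range_succ, ← add_assoc]
      exact (c.slab_mass_succ_le hΩ ha ha1 har hs0 hs hu k).trans (add_le_add ih le_rfl)
  refine (h1 k).trans (add_le_add le_rfl ?_)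
  rw [← Finset.mul_sum]
  refine mul_le_mul_right ((ENNReal.sum_le_tsum _).trans ?_) _
  exact tsum_gagliardo_layer_le hΩ.measurableSet c.continuous.measurable (by positivity) s u

/-- The Hardy integral over the union of the dyadic slabs of one chart. -/
lemma IsGraphChart.lintegral_iUnion_dyadicSlab_le (c : IsGraphChart Ω x₀ e h K r) (hΩ : IsOpen Ω)
    (hx₀ : x₀ ∈ frontier Ω) {a : ℝ} (ha : 0 < a) (ha1 : a ≤ 1) (har : a ≤ r / 32) {R : ℝ}
    (haR : a ≤ R) {m : ℕ} (hm : 1 ≤ m) {s : ℝ} (hs0 : 0 ≤ s) (hs : s < 1)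
    {u : EuclideanSpace ℝ (Fin d) → ℝ} (hu : Measurable u) :
    ∫⁻ x in ⋃ k, dyadicSlab x₀ e h r a k,
        ENNReal.ofReal (|u x| / bdist Ω x ^ s * logWeight m (bdist Ω x / R)) ≤
      ENNReal.ofReal (2 * K / a) * 3 * ((∫⁻ x in Ω, ENNReal.ofReal |u x|) +
        ENNReal.ofReal (incrementConst d K * (1 - s)) * (3 * gagliardo s Ω u)) := by
  have hK := c.K_pos
  set B := (∫⁻ x in Ω, ENNReal.ofReal |u x|) +
        ENNReal.ofReal (incrementConst d K * (1 - s)) * (3 * gagliardo s Ω u)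
  refine (lintegral_iUnion_le _ _).trans ?_
  have h1 : ∀ k : ℕ, ∫⁻ x in dyadicSlab x₀ e h r a k,
      ENNReal.ofReal (|u x| / bdist Ω x ^ s * logWeight m (bdist Ω x / R)) ≤
      ENNReal.ofReal (2 * K / a) * ENNReal.ofReal (logWeight m ((1 / 2) ^ k)) * B := by
    intro k
    have hp : (0 : ℝ) < (1 / 2) ^ k := by positivity
    have hp1 : ((1 : ℝ) / 2) ^ k ≤ 1 := pow_le_one₀ (by norm_num) (by norm_num)
    have hw := logWeight_nonneg m (t := (1 / 2) ^ k) ⟨hp, hp1⟩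
    calc _ ≤ ∫⁻ x in dyadicSlab x₀ e h r a k, ENNReal.ofReal (2 * K / a * logWeight m ((1 / 2) ^ k) *
          ((2 : ℝ) ^ s) ^ k) * ENNReal.ofReal |u x| := by
          refine setLIntegral_mono' (c.measurableSet_dyadicSlab a k) fun x hx => ?_
          obtain ⟨hb1, hb2⟩ := c.bdist_bounds hΩ hx₀ ha har hx
          have hb0 : 0 < a / (2 * K) * (1 / 2) ^ k := by positivity
          have hδ := hb0.trans_le hb1
          have hR : 0 < R := ha.trans_le haR
          rw [← ENNReal.ofReal_mul (by positivity)]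
          refine ENNReal.ofReal_le_ofReal ?_
          have hq : bdist Ω x / R ≤ (1 / 2) ^ k := by
            rw [div_le_iff₀ hR, mul_comm]
            exact hb2.trans (mul_le_mul_of_nonneg_right haR hp.le)
          have hw1 := logWeight_mono m (div_pos hδ hR) hq hp1
          have hq0 := logWeight_nonneg m (t := bdist Ω x / R) ⟨div_pos hδ hR, hq.trans hp1⟩
          have hs1 : (bdist Ω x ^ s)⁻¹ ≤ 2 * K / a * ((2 : ℝ) ^ s) ^ k := by
            calc (bdist Ω x ^ s)⁻¹ ≤ ((a / (2 * K) * (1 / 2) ^ k) ^ s)⁻¹ :=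
                  inv_anti₀ (Real.rpow_pos_of_pos hb0 s) (Real.rpow_le_rpow hb0.le hb1 hs0)
              _ = (2 * K / a) ^ s * ((2 : ℝ) ^ s) ^ k := by
                  rw [← Real.inv_rpow hb0.le, mul_inv, inv_div, one_div, inv_pow, inv_inv,
                    Real.mul_rpow (by positivity) (by positivity), ← Real.rpow_natCast,
                    ← Real.rpow_mul (by norm_num), ← Real.rpow_natCast,
                    ← Real.rpow_mul (by norm_num), mul_comm s]
              _ ≤ _ := by
                  gcongr
                  conv_rhs => rw [← Real.rpow_one (2 * K / a)]
                  refine Real.rpow_le_rpow_of_exponent_le ?_ hs.le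
                  rw [le_div_iff₀ ha]
                  linarith [c.one_le]
          calc |u x| / bdist Ω x ^ s * logWeight m (bdist Ω x / R)
              = |u x| * (bdist Ω x ^ s)⁻¹ * logWeight m (bdist Ω x / R) := by
                rw [div_eq_mul_inv]
            _ ≤ |u x| * (2 * K / a * ((2 : ℝ) ^ s) ^ k) * logWeight m ((1 / 2) ^ k) := by
                gcongr
            _ = _ := by ring
      _ = ENNReal.ofReal (2 * K / a) * ENNReal.ofReal (logWeight m ((1 / 2) ^ k)) *
          (ENNReal.ofReal (((2 : ℝ) ^ s) ^ k) *
            ∫⁻ x in dyadicSlab x₀ e h r a k, ENNReal.ofReal |u x|) := by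
          rw [lintegral_const_mul _ hu.abs.ennreal_ofReal, ENNReal.ofReal_mul (by positivity),
            ENNReal.ofReal_mul (by positivity), mul_assoc]
      _ ≤ _ := by
          gcongr
          exact c.slab_mass_le hΩ ha ha1 har hs0 hs hu k
  refine (ENNReal.tsum_le_tsum h1).trans ?_
  rw [ENNReal.tsum_mul_right, ENNReal.tsum_mul_left]
  gcongr
  exact tsum_logWeight_le m hm

lemma IsGraphChart.inter_ball_subset (c : IsGraphChart Ω x₀ e h K r) (hΩ : IsOpen Ω)
    (hx₀ : x₀ ∈ frontier Ω) {a : ℝ} (ha : 0 < a) (har : a ≤ r / 32) :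
    Ω ∩ Metric.ball x₀ (a / (2 * K)) ⊆ ⋃ k, dyadicSlab x₀ e h r a k := by
  rintro x ⟨hxΩ, hx⟩
  have hK := c.K_pos
  have hr := c.r_pos
  have hx : ‖x - x₀‖ < a / (2 * K) := mem_ball_iff_norm.1 hx
  rw [lt_div_iff₀ (by positivity)] at hx
  have hn : ‖x - x₀‖ < a / 2 := by nlinarith [norm_nonneg (x - x₀), c.one_le]
  have h0 : 0 < h x := (c.mem_iff x (mem_ball_iff_norm.2 (by linarith))).1 hxΩ
  have hx₀0 : h x₀ ≤ 0 := by
    have h1 : x₀ ∉ Ω := by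
      have := hx₀.2
      rwa [hΩ.interior_eq] at this
    exact not_lt.1 fun h2 => h1 (c.mem_of_norm_lt (by simpa using hr) h2)
  have hha : h x ≤ a := by linarith [(abs_le.1 (c.lip x x₀)).2]
  obtain ⟨k, hk1, hk2⟩ := exists_nat_pow_near_of_lt_one (div_pos h0 ha)
    ((div_le_one ha).2 hha) (by norm_num : (0 : ℝ) < 1 / 2) (by norm_num)
  rw [lt_div_iff₀ ha] at hk1
  rw [div_le_iff₀ ha] at hk2
  refine mem_iUnion.2 ⟨k, ?_, by linarith, by linarith⟩
  have h3 : x - h x • e - x₀ = (x - x₀) - h x • e := by abel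
  have h4 := norm_sub_le (x - x₀) (h x • e)
  rw [c.norm_smul_e, abs_of_pos h0] at h4
  rw [h3]
  linarith

end Slabs

/-! ### The inequality on the domain -/

section Domain

variable {n : ℕ} {Ω : Set (EuclideanSpace ℝ (Fin (n + 1)))}

lemma IsBoundedLipschitzDomain.nonempty_frontier (hΩ : IsBoundedLipschitzDomain Ω) :
    (frontier Ω).Nonempty := by
  by_contra h0
  have h1 : IsClopen Ω := isClopen_iff_frontier_eq_empty.2 (not_nonempty_iff_eq_empty.1 h0)
  have h2 : Ω = univ := h1.eq_univ hΩ.nonempty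
  have h3 := hΩ.isBounded
  rw [h2] at h3
  exact NormedSpace.unbounded_univ ℝ (EuclideanSpace ℝ (Fin (n + 1))) h3

lemma IsBoundedLipschitzDomain.bdist_pos (hΩ : IsBoundedLipschitzDomain Ω)
    {x : EuclideanSpace ℝ (Fin (n + 1))} (hx : x ∈ Ω) : 0 < bdist Ω x := by
  refine (isClosed_frontier.notMem_iff_infDist_pos hΩ.nonempty_frontier).1 fun h => ?_
  have := h.2
  rw [hΩ.isOpen.interior_eq] at this
  exact this hx

/-- A chart at `x₀` together with a scale `a` that is small compared with the chart and with the
domain. -/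
lemma IsBoundedLipschitzDomain.exists_chart_scale (hΩ : IsBoundedLipschitzDomain Ω)
    {x₀ : EuclideanSpace ℝ (Fin (n + 1))} (hx₀ : x₀ ∈ frontier Ω) :
    ∃ e h K r a, IsGraphChart Ω x₀ e h K r ∧ 0 < a ∧ a ≤ 1 ∧ a ≤ r / 32 ∧
      ∀ R, (∀ x ∈ Ω, bdist Ω x < R) → a ≤ R := by
  obtain ⟨e, h, K, r, c⟩ := hΩ.exists_isGraphChart hx₀
  obtain ⟨x₁, hx₁⟩ := hΩ.nonempty
  have hr := c.r_pos
  have hb := hΩ.bdist_pos hx₁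
  refine ⟨e, h, K, r, min 1 (min (r / 32) (bdist Ω x₁)), c, by positivity, min_le_left _ _,
    (min_le_right _ _).trans (min_le_left _ _), fun R hR => ?_⟩
  exact ((min_le_right _ _).trans (min_le_right _ _)).trans (hR x₁ hx₁).le

/-- The logarithmic Hardy inequality for the part of the integral over `A`, with a constant uniform
in `R`, `m`, `s` and `u`. -/
def HardyBoundOn (Ω A : Set (EuclideanSpace ℝ (Fin (n + 1)))) : Prop :=
  ∃ C : ℝ, 0 ≤ C ∧ ∀ R : ℝ, (∀ x ∈ Ω, bdist Ω x < R) → ∀ m : ℕ, 1 ≤ m →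
    ∀ s : ℝ, 0 ≤ s → s < 1 → ∀ u : EuclideanSpace ℝ (Fin (n + 1)) → ℝ, Measurable u →
      ∫⁻ x in Ω ∩ A, ENNReal.ofReal (|u x| / bdist Ω x ^ s * logWeight m (bdist Ω x / R)) ≤
        ENNReal.ofReal C * (ENNReal.ofReal (1 - s) * gagliardo s Ω u +
          ∫⁻ x in Ω, ENNReal.ofReal |u x|)

lemma HardyBoundOn.mono {A B : Set (EuclideanSpace ℝ (Fin (n + 1)))} (hAB : A ⊆ B)
    (hB : HardyBoundOn Ω B) : HardyBoundOn Ω A := by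
  obtain ⟨C, hC, h⟩ := hB
  exact ⟨C, hC, fun R hR m hm s hs0 hs u hu =>
    (lintegral_mono_set (inter_subset_inter_right _ hAB)).trans (h R hR m hm s hs0 hs u hu)⟩

lemma HardyBoundOn.union {A B : Set (EuclideanSpace ℝ (Fin (n + 1)))}
    (hA : HardyBoundOn Ω A) (hB : HardyBoundOn Ω B) : HardyBoundOn Ω (A ∪ B) := by
  obtain ⟨C, hC, h⟩ := hA
  obtain ⟨C', hC', h'⟩ := hB
  refine ⟨C + C', by positivity, fun R hR m hm s hs0 hs u hu => ?_⟩
  rw [inter_union_distrib_left, ENNReal.ofReal_add hC hC', add_mul]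
  exact (lintegral_union_le _ _ _).trans
    (add_le_add (h R hR m hm s hs0 hs u hu) (h' R hR m hm s hs0 hs u hu))

lemma IsBoundedLipschitzDomain.hardyBoundOn_boundary (hΩ : IsBoundedLipschitzDomain Ω)
    {x₀ : EuclideanSpace ℝ (Fin (n + 1))} (hx₀ : x₀ ∈ frontier Ω) :
    ∃ ε > 0, HardyBoundOn Ω (Metric.ball x₀ ε) := by
  obtain ⟨e, h, K, r, a, c, ha, ha1, har, haR⟩ := hΩ.exists_chart_scale hx₀
  have hK := c.K_pos
  have hI : 0 ≤ incrementConst (n + 1) K := by unfold incrementConst; positivity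
  refine ⟨a / (2 * K), by positivity, 2 * K / a * 3 * (1 + 3 * incrementConst (n + 1) K),
    by positivity, fun R hR m hm s hs0 hs u hu => ?_⟩
  refine (lintegral_mono_set (c.inter_ball_subset hΩ.isOpen hx₀ ha har)).trans ?_
  refine (c.lintegral_iUnion_dyadicSlab_le hΩ.isOpen hx₀ ha ha1 har (haR R hR) hm hs0 hs hu).trans ?_
  have e1 : ENNReal.ofReal (2 * K / a * 3 * (1 + 3 * incrementConst (n + 1) K)) =
      ENNReal.ofReal (2 * K / a) * 3 * (1 + 3 * ENNReal.ofReal (incrementConst (n + 1) K)) := by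
    rw [ENNReal.ofReal_mul (by positivity), ENNReal.ofReal_mul (by positivity),
      ENNReal.ofReal_add zero_le_one (by positivity), ENNReal.ofReal_mul (by norm_num),
      ENNReal.ofReal_one, ENNReal.ofReal_ofNat]
  rw [e1, ENNReal.ofReal_mul hI, mul_assoc _ (1 + _)]
  gcongr
  set X := ∫⁻ x in Ω, ENNReal.ofReal |u x|
  set G := ENNReal.ofReal (1 - s) * gagliardo s Ω u with hG
  set J := ENNReal.ofReal (incrementConst (n + 1) K)
  calc X + J * ENNReal.ofReal (1 - s) * (3 * gagliardo s Ω u) = X + 3 * J * G := by rw [hG]; ring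
    _ ≤ (X + 3 * J * G) + (G + 3 * J * X) := le_self_add
    _ = (1 + 3 * J) * (G + X) := by ring

lemma IsBoundedLipschitzDomain.hardyBoundOn_interior (hΩ : IsBoundedLipschitzDomain Ω)
    {x₀ : EuclideanSpace ℝ (Fin (n + 1))} (hx₀ : x₀ ∈ Ω) :
    ∃ ε > 0, HardyBoundOn Ω (Metric.ball x₀ ε) := by
  have hb := hΩ.bdist_pos hx₀
  -- The minimum with `1` makes `ε ^ (-s)` at most `1 / ε`, uniformly in `s`.
  set ε := min 1 (bdist Ω x₀ / 2) with hε
  have hε0 : 0 < ε := by positivity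
  have hε1 : ε ≤ 1 := min_le_left _ _
  refine ⟨ε, hε0, 1 / ε, by positivity, fun R hR m hm s hs0 hs u hu => ?_⟩
  calc _ ≤ ∫⁻ x in Ω ∩ Metric.ball x₀ ε, ENNReal.ofReal (1 / ε) * ENNReal.ofReal |u x| := by
        refine setLIntegral_mono' (hΩ.isOpen.measurableSet.inter measurableSet_ball) fun x hx => ?_
        have hδ : ε ≤ bdist Ω x := by
          have h1 : bdist Ω x₀ ≤ bdist Ω x + dist x₀ x := Metric.infDist_le_infDist_add_dist
          have h2 : dist x x₀ < ε := hx.2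
          have h3 : ε ≤ bdist Ω x₀ / 2 := min_le_right _ _
          rw [dist_comm] at h1
          linarith
        have hR' := hR x hx.1
        have hδ0 := hε0.trans_le hδ
        have ht : bdist Ω x / R ∈ Ioc (0 : ℝ) 1 :=
          ⟨div_pos hδ0 (hδ0.trans hR'), (div_le_one (hδ0.trans hR')).2 hR'.le⟩
        rw [← ENNReal.ofReal_mul (by positivity)]
        refine ENNReal.ofReal_le_ofReal ?_
        have h1 : ε ≤ bdist Ω x ^ s := by
          calc ε = ε ^ (1 : ℝ) := (Real.rpow_one ε).symm
            _ ≤ ε ^ s := Real.rpow_le_rpow_of_exponent_ge hε0 hε1 hs.le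
            _ ≤ _ := Real.rpow_le_rpow hε0.le hδ hs0
        calc |u x| / bdist Ω x ^ s * logWeight m (bdist Ω x / R)
            ≤ |u x| / ε * 1 := by
              gcongr
              · exact logWeight_nonneg m ht
              · exact logWeight_le_one m ht
          _ = _ := by ring
    _ = ENNReal.ofReal (1 / ε) * ∫⁻ x in Ω ∩ Metric.ball x₀ ε, ENNReal.ofReal |u x| :=
        lintegral_const_mul _ hu.abs.ennreal_ofReal
    _ ≤ _ := by
        gcongr
        exact (lintegral_mono_set inter_subset_left).trans le_add_self

/-- The local bounds near the points of the compact set `closure Ω` add up to a global one. -/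
lemma IsBoundedLipschitzDomain.hardyBoundOn_closure (hΩ : IsBoundedLipschitzDomain Ω) :
    HardyBoundOn Ω (closure Ω) := by
  refine hΩ.isBounded.isCompact_closure.induction_on (p := HardyBoundOn Ω) ?_
    (fun A B hAB hB => hB.mono hAB) (fun A B hA hB => hA.union hB) fun x hx => ?_
  · exact ⟨0, le_rfl, fun R hR m hm s hs0 hs u hu => by simp⟩
  · have : ∃ ε > 0, HardyBoundOn Ω (Metric.ball x ε) := by
      by_cases hxΩ : x ∈ Ω
      · exact hΩ.hardyBoundOn_interior hxΩ
      · exact hΩ.hardyBoundOn_boundary ⟨hx, by rwa [hΩ.isOpen.interior_eq]⟩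
    obtain ⟨ε, hε, hball⟩ := this
    exact ⟨_, mem_nhdsWithin_of_mem_nhds (Metric.ball_mem_nhds x hε), hball⟩

lemma gagliardo_congr_ae {d : ℕ} {Ω : Set (EuclideanSpace ℝ (Fin d))} (s : ℝ)
    {u v : EuclideanSpace ℝ (Fin d) → ℝ} (huv : u =ᵐ[volume.restrict Ω] v) :
    gagliardo s Ω u = gagliardo s Ω v := by
  unfold gagliardo
  refine lintegral_congr_ae ?_
  filter_upwards [huv] with x hx
  refine lintegral_congr_ae ?_
  filter_upwards [huv] with y hy
  rw [hx, hy]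

/-- The logarithmic Hardy inequality, with a constant that does not depend on `m`. -/
lemma IsBoundedLipschitzDomain.exists_hardyInt_le (hΩ : IsBoundedLipschitzDomain Ω) :
    ∃ C : ℝ, 0 < C ∧ ∀ R : ℝ, (∀ x ∈ Ω, bdist Ω x < R) → ∀ m : ℕ, 1 ≤ m →
      ∀ s : ℝ, 0 ≤ s → s < 1 → ∀ u : EuclideanSpace ℝ (Fin (n + 1)) → ℝ, MemWs1 s Ω u →
        hardyInt s R m Ω u ≤
          ENNReal.ofReal C * (ENNReal.ofReal (1 - s) * gagliardo s Ω u + normL1 Ω u) := by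
  obtain ⟨C, hC, h⟩ := hΩ.hardyBoundOn_closure
  refine ⟨C + 1, by positivity, fun R hR m hm s hs0 hs u hu => ?_⟩
  obtain ⟨v, hv, huv⟩ := hu.1.1.aemeasurable
  have h1 := h R hR m hm s hs0 hs v hv
  rw [inter_eq_self_of_subset_left subset_closure, ← gagliardo_congr_ae s huv] at h1
  have h2 : normL1 Ω u = ∫⁻ x in Ω, ENNReal.ofReal |v x| := by
    unfold normL1
    rw [eLpNorm_one_eq_lintegral_enorm]
    refine lintegral_congr_ae ?_
    filter_upwards [huv] with x hx
    rw [hx, Real.enorm_eq_ofReal_abs]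
  have h3 : hardyInt s R m Ω u = ∫⁻ x in Ω,
      ENNReal.ofReal (|v x| / bdist Ω x ^ s * logWeight m (bdist Ω x / R)) := by
    unfold hardyInt
    refine lintegral_congr_ae ?_
    filter_upwards [huv] with x hx
    rw [hx]
  rw [h2, h3]
  exact h1.trans (mul_le_mul_left (ENNReal.ofReal_le_ofReal (by linarith)) _)

end Domain

/-! ### Failure of the series inequality -/

section LowerBound

variable {d : ℕ} {Ω : Set (EuclideanSpace ℝ (Fin d))} {x₀ e : EuclideanSpace ℝ (Fin d)}
  {h : EuclideanSpace ℝ (Fin d) → ℝ} {K r : ℝ}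

lemma IsGraphChart.volume_dyadicSlab (c : IsGraphChart Ω x₀ e h K r) {a : ℝ} (ha : 0 < a)
    (k : ℕ) : volume (dyadicSlab x₀ e h r a k) =
      ENNReal.ofReal ((1 / 2) ^ k) * volume (dyadicSlab x₀ e h r a 0) := by
  induction k with
  | zero => simp
  | succ k ih =>
    set τ := a / 4 * (1 / 2) ^ k with hτd
    have hτ : 0 < τ := by positivity
    have e1 : dyadicSlab x₀ e h r a (k + 1) = slab x₀ e h r (Ioc τ (2 * τ)) := by
      unfold dyadicSlab; congr 2 <;> rw [hτd] <;> ring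
    have e2 : dyadicSlab x₀ e h r a k = slab x₀ e h r (Ioc (2 * τ) (4 * τ)) := by
      unfold dyadicSlab; congr 2 <;> rw [hτd] <;> ring
    have h1 := c.lintegral_slab_double hτ.le (fun _ => 1)
    rw [setLIntegral_one, setLIntegral_one, ← e1, ← e2, ← two_mul, ih] at h1
    have h2 : (2 : ENNReal) = ENNReal.ofReal 2 := by norm_num
    have h3 : ENNReal.ofReal (1 / 2) * 2 = 1 := by
      rw [h2, ← ENNReal.ofReal_mul (by norm_num)]; norm_num
    calc _ = ENNReal.ofReal (1 / 2) * (2 * volume (dyadicSlab x₀ e h r a (k + 1))) := by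
          rw [← mul_assoc, h3, one_mul]
      _ = _ := by
          rw [← h1, ← mul_assoc, ← ENNReal.ofReal_mul (by norm_num), pow_succ, mul_comm (1 / 2 : ℝ)]

lemma IsGraphChart.volume_dyadicSlab_zero_pos (c : IsGraphChart Ω x₀ e h K r) {a : ℝ}
    (ha : 0 < a) (hx₀ : h x₀ = 0) : 0 < volume (dyadicSlab x₀ e h r a 0) := by
  have h1 : Continuous fun x => ‖x - h x • e - x₀‖ :=
    ((continuous_id.sub (c.continuous.smul continuous_const)).sub continuous_const).norm
  have ho : IsOpen ({x | ‖x - h x • e - x₀‖ < r / 4} ∩ h ⁻¹' Ioo (a / 2) a) :=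
    (isOpen_lt h1 continuous_const).inter (isOpen_Ioo.preimage c.continuous)
  refine (ho.measure_pos volume ⟨x₀ + (3 / 4 * a) • e, ?_⟩).trans_le (measure_mono ?_)
  · have h2 : h (x₀ + (3 / 4 * a) • e) = 3 / 4 * a := by rw [c.add_smul, hx₀, zero_add]
    refine ⟨?_, ?_⟩
    · rw [mem_ofPred_eq, h2]
      simpa using c.r_pos
    · rw [mem_preimage, h2]
      constructor <;> linarith
  · rintro x ⟨hx1, hx2, hx3⟩
    exact ⟨hx1, by linarith, by linarith⟩

lemma IsGraphChart.height_eq_zero (c : IsGraphChart Ω x₀ e h K r) (hΩ : IsOpen Ω)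
    (hx₀ : x₀ ∈ frontier Ω) : h x₀ = 0 := by
  have hball := Metric.mem_ball_self (x := x₀) c.r_pos
  refine le_antisymm (not_lt.1 fun h0 => ?_) (not_lt.1 fun h0 => ?_)
  · have := hx₀.2
    rw [hΩ.interior_eq] at this
    exact this ((c.mem_iff _ hball).2 h0)
  · have hev : ∀ᶠ x in 𝓝 x₀, x ∈ Metric.ball x₀ r ∧ h x < 0 :=
      Filter.Eventually.and (Metric.isOpen_ball.mem_nhds hball)
        (c.continuous.continuousAt.eventually (gt_mem_nhds h0))
    obtain ⟨x, hxΩ, hx1, hx2⟩ := ((mem_closure_iff_frequently.1 hx₀.1).and_eventually hev).exists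
    linarith [(c.mem_iff x hx1).1 hxΩ]

/-- Lower bound for the Hardy integral of the constant function `1`, in terms of the weights at
dyadic points. -/
lemma IsGraphChart.le_hardyInt_one (c : IsGraphChart Ω x₀ e h K r) (hΩ : IsOpen Ω)
    (hx₀ : x₀ ∈ frontier Ω) {a : ℝ} (ha : 0 < a) (ha1 : a ≤ 1) (har : a ≤ r / 32) {R : ℝ}
    (haR : a ≤ R) (m : ℕ) {s : ℝ} (hs0 : 0 ≤ s) (N : ℕ) :
    ENNReal.ofReal (∑ k ∈ Finset.range N,
        ((2 : ℝ) ^ (s - 1)) ^ k * logWeight m (a / (2 * K * R) * (1 / 2) ^ k)) *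
      volume (dyadicSlab x₀ e h r a 0) ≤ hardyInt s R m Ω fun _ => 1 := by
  have hK := c.K_pos
  have hR : 0 < R := ha.trans_le haR
  have hcpos : ∀ k : ℕ, 0 < a / (2 * K * R) * (1 / 2) ^ k := fun k => by positivity
  have hc1 : ∀ k : ℕ, a / (2 * K * R) * (1 / 2) ^ k ≤ 1 := fun k => by
    refine mul_le_one₀ ?_ (by positivity) (pow_le_one₀ (by norm_num) (by norm_num))
    rw [div_le_one (by positivity)]
    nlinarith [c.one_le, mul_le_mul_of_nonneg_right c.one_le hR.le]
  have hw : ∀ k : ℕ, 0 ≤ logWeight m (a / (2 * K * R) * (1 / 2) ^ k) := fun k =>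
    logWeight_nonneg m ⟨hcpos k, hc1 k⟩
  have hdisj : Pairwise (Function.onFun Disjoint (dyadicSlab x₀ e h r a)) := by
    intro j j' hne
    have := pairwise_disjoint_dyadic (half_pos ha) hne
    have e1 : ∀ k : ℕ, Ioc (a * (1 / 2) ^ (k + 1)) (a * (1 / 2) ^ k) =
        Ioc (a / 2 * (1 / 2 : ℝ) ^ k) (2 * (a / 2 * (1 / 2) ^ k)) := fun k => by
      congr 1 <;> ring
    refine disjoint_slab ?_
    rw [e1, e1]
    exact this
  calc _ = ∑ k ∈ Finset.range N, ENNReal.ofReal (((2 : ℝ) ^ s) ^ k *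
          logWeight m (a / (2 * K * R) * (1 / 2) ^ k)) * volume (dyadicSlab x₀ e h r a k) := by
        rw [ENNReal.ofReal_sum_of_nonneg fun k _ => mul_nonneg (by positivity) (hw k),
          Finset.sum_mul]
        refine Finset.sum_congr rfl fun k _ => ?_
        rw [c.volume_dyadicSlab ha k, ← mul_assoc, ← ENNReal.ofReal_mul
          (mul_nonneg (by positivity) (hw k))]
        congr 2
        rw [Real.rpow_sub_one (by norm_num), div_pow, one_div, inv_pow]
        ring
    _ ≤ ∑ k ∈ Finset.range N, ∫⁻ x in dyadicSlab x₀ e h r a k,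
          ENNReal.ofReal (|(1 : ℝ)| / bdist Ω x ^ s * logWeight m (bdist Ω x / R)) := by
        refine Finset.sum_le_sum fun k _ => ?_
        rw [← setLIntegral_const]
        refine setLIntegral_mono' (c.measurableSet_dyadicSlab a k) fun x hx => ?_
        obtain ⟨hb1, hb2⟩ := c.bdist_bounds hΩ hx₀ ha har hx
        have hδ : 0 < bdist Ω x := lt_of_lt_of_le (by positivity) hb1
        refine ENNReal.ofReal_le_ofReal (mul_le_mul ?_ ?_ (hw k) (by positivity))
        · rw [abs_one, le_div_iff₀ (Real.rpow_pos_of_pos hδ s)]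
          calc ((2 : ℝ) ^ s) ^ k * bdist Ω x ^ s
              ≤ ((2 : ℝ) ^ s) ^ k * ((1 / 2) ^ k) ^ s := by
                gcongr
                exact hb2.trans (mul_le_of_le_one_left (by positivity) ha1)
            _ = 1 := by
                rw [← Real.rpow_natCast, ← Real.rpow_mul (by norm_num), mul_comm s,
                  Real.rpow_mul (by norm_num), Real.rpow_natCast,
                  ← Real.mul_rpow (by positivity) (by positivity), ← mul_pow]
                norm_num
        · refine logWeight_mono m (hcpos k) ?_ ?_
          · rw [le_div_iff₀ hR]
            refine le_trans (le_of_eq ?_) hb1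
            field_simp
          · rw [div_le_one hR]
            exact hb2.trans ((mul_le_of_le_one_right ha.le
              (pow_le_one₀ (by norm_num) (by norm_num))).trans haR)
    _ ≤ ∑' k, ∫⁻ x in dyadicSlab x₀ e h r a k,
          ENNReal.ofReal (|(1 : ℝ)| / bdist Ω x ^ s * logWeight m (bdist Ω x / R)) :=
        ENNReal.sum_le_tsum _
    _ = ∫⁻ x in ⋃ k, dyadicSlab x₀ e h r a k,
          ENNReal.ofReal (|(1 : ℝ)| / bdist Ω x ^ s * logWeight m (bdist Ω x / R)) :=
        (lintegral_iUnion (c.measurableSet_dyadicSlab a) hdisj _).symm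
    _ ≤ _ := lintegral_mono_set (iUnion_subset (c.dyadicSlab_subset ha har))

end LowerBound

lemma IsBoundedLipschitzDomain.volume_lt_top {n : ℕ} {Ω : Set (EuclideanSpace ℝ (Fin (n + 1)))}
    (hΩ : IsBoundedLipschitzDomain Ω) : volume Ω < ⊤ :=
  hΩ.isBounded.measure_lt_top

/-- The series inequality fails for `α ≥ 1`. For `u = 1` the right-hand side is bounded, while the
`m`-th integral tends, as `s → 1`, to a limit bounded below independently of `m`. -/
lemma IsBoundedLipschitzDomain.not_exists_hardySeries_le {n : ℕ}
    {Ω : Set (EuclideanSpace ℝ (Fin (n + 1)))} (hΩ : IsBoundedLipschitzDomain Ω) {R : ℝ}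
    (hR : ∀ x ∈ Ω, bdist Ω x < R) {α : ℝ} (hα : 1 ≤ α) :
    ¬ ∃ C : ℝ, 0 < C ∧ ∀ s : ℝ, 1 / 2 ≤ s → s < 1 →
      ∀ u : EuclideanSpace ℝ (Fin (n + 1)) → ℝ, MemWs1 s Ω u →
        hardySeries s R α Ω u ≤
          ENNReal.ofReal C * (ENNReal.ofReal (1 - s) * gagliardo s Ω u + normL1 Ω u) := by
  rintro ⟨C, hC, hbound⟩
  obtain ⟨x₀, hx₀⟩ := hΩ.nonempty_frontier
  obtain ⟨e, h, K, r, a, c, ha, ha1, har, haR⟩ := hΩ.exists_chart_scale hx₀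
  have haR := haR R hR
  have hK := c.K_pos
  have hR0 : 0 < R := ha.trans_le haR
  set V := volume (dyadicSlab x₀ e h r a 0) with hV
  have hV0 : 0 < V := c.volume_dyadicSlab_zero_pos ha (c.height_eq_zero hΩ.isOpen hx₀)
  have hVtop : V < ⊤ := (measure_mono (c.dyadicSlab_subset ha har 0)).trans_lt hΩ.volume_lt_top
  set b := a / (2 * K * R) with hb
  have hb0 : b ∈ Ioc (0 : ℝ) 1 := by
    refine ⟨by positivity, ?_⟩
    rw [hb, div_le_one (by positivity)]
    nlinarith [c.one_le, mul_le_mul_of_nonneg_right c.one_le hR0.le]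
  choose N hN using fun m : ℕ => exists_le_sum_logWeight (m + 2) (by omega) hb0
  let f : ℕ → ℝ → ℝ := fun M s => ∑ m ∈ Finset.range M, ∑ k ∈ Finset.range (N m),
    ((2 : ℝ) ^ (s - 1)) ^ k * logWeight (m + 2) (b * (1 / 2) ^ k)
  have hw : ∀ m k : ℕ, 0 ≤ logWeight m (b * (1 / 2) ^ k) := fun m k =>
    logWeight_nonneg m ⟨mul_pos hb0.1 (by positivity),
      mul_le_one₀ hb0.2 (by positivity) (pow_le_one₀ (by norm_num) (by norm_num))⟩
  have hone : ∀ s : ℝ, gagliardo s Ω (fun _ => 1) = 0 := fun s => by simp [gagliardo]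
  have hnorm : normL1 Ω (fun _ => 1) = volume Ω := by
    unfold normL1
    rw [eLpNorm_one_eq_lintegral_enorm]
    simp
  have hf : ∀ M : ℕ, ∀ s : ℝ, 1 / 2 ≤ s → s < 1 →
      f M s ≤ (ENNReal.ofReal C * volume Ω / V).toReal := by
    intro M s hs0 hs
    have : IsFiniteMeasure (volume.restrict Ω) := ⟨by simpa using hΩ.volume_lt_top⟩
    have h1 := hbound s hs0 hs (fun _ => 1)
      ⟨memLp_const 1, by rw [hone]; exact ENNReal.zero_lt_top⟩
    rw [hone, mul_zero, zero_add, hnorm] at h1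
    have h2 : ENNReal.ofReal (f M s) * V ≤ ENNReal.ofReal C * volume Ω := by
      calc ENNReal.ofReal (f M s) * V
          = ∑ m ∈ Finset.range M, ENNReal.ofReal (∑ k ∈ Finset.range (N m),
              ((2 : ℝ) ^ (s - 1)) ^ k * logWeight (m + 2) (b * (1 / 2) ^ k)) * V := by
            rw [ENNReal.ofReal_sum_of_nonneg fun m _ =>
              Finset.sum_nonneg fun k _ => mul_nonneg (by positivity) (hw _ _), Finset.sum_mul]
        _ ≤ ∑ m ∈ Finset.range M, ENNReal.ofReal (α ^ (m + 2)) *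
              hardyInt s R (m + 2) Ω (fun _ => 1) := by
            refine Finset.sum_le_sum fun m _ => ?_
            refine (c.le_hardyInt_one hΩ.isOpen hx₀ ha ha1 har haR (m + 2) (by linarith) _).trans ?_
            refine le_mul_of_one_le_left zero_le ?_
            rw [ENNReal.one_le_ofReal]
            exact one_le_pow₀ hα
        _ ≤ hardySeries s R α Ω (fun _ => 1) := ENNReal.sum_le_tsum _
        _ ≤ _ := h1
    have hfin : ENNReal.ofReal C * volume Ω / V ≠ ⊤ :=
      ENNReal.div_ne_top (ENNReal.mul_ne_top ENNReal.ofReal_ne_top hΩ.volume_lt_top.ne) hV0.ne'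
    refine (ENNReal.ofReal_le_iff_le_toReal hfin).1 ?_
    rwa [ENNReal.le_div_iff_mul_le (Or.inl hV0.ne') (Or.inl hVtop.ne)]
  have hlim : ∀ M : ℕ, (M : ℝ) * (b / 2) ≤ (ENNReal.ofReal C * volume Ω / V).toReal := by
    intro M
    have hcont : Continuous (f M) := by
      refine continuous_finsetSum _ fun m _ => continuous_finsetSum _ fun k _ => ?_
      refine Continuous.mul (Continuous.pow ?_ k) continuous_const
      exact Real.continuous_const_rpow (by norm_num) |>.comp (continuous_id.sub continuous_const)
    have h1 : f M 1 ≤ (ENNReal.ofReal C * volume Ω / V).toReal := by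
      refine le_of_tendsto ((hcont.tendsto 1).mono_left nhdsWithin_le_nhds :
        Tendsto (f M) (𝓝[<] 1) (𝓝 (f M 1))) ?_
      filter_upwards [Ioo_mem_nhdsLT (by norm_num : (1 / 2 : ℝ) < 1)] with s hs
      exact hf M s hs.1.le hs.2
    refine le_trans ?_ h1
    calc (M : ℝ) * (b / 2) = ∑ m ∈ Finset.range M, b / 2 := by simp
      _ ≤ _ := Finset.sum_le_sum fun m _ => by simpa using hN m
  obtain ⟨M, hM⟩ := exists_nat_gt ((ENNReal.ofReal C * volume Ω / V).toReal / (b / 2))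
  rw [div_lt_iff₀ (half_pos hb0.1)] at hM
  exact absurd (hlim M) (not_le.2 hM)

/-- Summing a bound `C 2 ^ m` for the single integrals gives the geometric series of `2 α`. -/
lemma hardySeries_le_of_hardyInt_le {d : ℕ} {Ω : Set (EuclideanSpace ℝ (Fin d))} {s R α C : ℝ}
    {u : EuclideanSpace ℝ (Fin d) → ℝ} {B : ENNReal} (hC : 0 ≤ C) (hα0 : 0 < α) (hα : α < 1 / 2)
    (h : ∀ m : ℕ, 2 ≤ m → hardyInt s R m Ω u ≤ ENNReal.ofReal (C * 2 ^ m) * B) :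
    hardySeries s R α Ω u ≤ ENNReal.ofReal (C * (4 * α ^ 2 / (1 - 2 * α))) * B := by
  have hs : HasSum (fun k : ℕ => C * (4 * α ^ 2 * (2 * α) ^ k)) (C * (4 * α ^ 2 / (1 - 2 * α))) := by
    rw [div_eq_mul_inv]
    exact ((hasSum_geometric_of_lt_one (by linarith) (by linarith)).mul_left _).mul_left _
  calc hardySeries s R α Ω u
      ≤ ∑' k : ℕ, ENNReal.ofReal (C * (4 * α ^ 2 * (2 * α) ^ k)) * B := by
        refine ENNReal.tsum_le_tsum fun k => ?_
        refine (mul_le_mul_right (h (k + 2) (by omega)) _).trans (le_of_eq ?_)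
        rw [← mul_assoc, ← ENNReal.ofReal_mul (by positivity)]
        congr 2
        ring
    _ = _ := by
        rw [ENNReal.tsum_mul_right, ← ENNReal.ofReal_tsum_of_nonneg (fun k => by positivity)
          hs.summable, hs.tsum_eq]

end BoundaryHardy

theorem theorem1p4 (n : ℕ) (Ω : Set (EuclideanSpace ℝ (Fin (n + 1))))
    (hΩ : BoundaryHardy.IsBoundedLipschitzDomain Ω) :
    -- the inequality for each single `m`, with a constant depending only on the domain
    (∃ C : ℝ, 0 < C ∧
      ∀ R : ℝ, (∀ x ∈ Ω, BoundaryHardy.bdist Ω x < R) →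
      ∀ m : ℕ, 2 ≤ m → ∀ s : ℝ, 1 / 2 ≤ s → s < 1 →
      ∀ u : EuclideanSpace ℝ (Fin (n + 1)) → ℝ, BoundaryHardy.MemWs1 s Ω u →
        BoundaryHardy.hardyInt s R m Ω u ≤
          ENNReal.ofReal (C * 2 ^ m) *
            (ENNReal.ofReal (1 - s) * BoundaryHardy.gagliardo s Ω u +
              BoundaryHardy.normL1 Ω u)) ∧
    -- the inequality for the series when `0 < α < 1/2`
    (∃ C : ℝ, 0 < C ∧
      ∀ R : ℝ, (∀ x ∈ Ω, BoundaryHardy.bdist Ω x < R) →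
      ∀ α : ℝ, 0 < α → α < 1 / 2 → ∀ s : ℝ, 1 / 2 ≤ s → s < 1 →
      ∀ u : EuclideanSpace ℝ (Fin (n + 1)) → ℝ, BoundaryHardy.MemWs1 s Ω u →
        BoundaryHardy.hardySeries s R α Ω u ≤
          ENNReal.ofReal (C * (4 * α ^ 2 / (1 - 2 * α))) *
            (ENNReal.ofReal (1 - s) * BoundaryHardy.gagliardo s Ω u +
              BoundaryHardy.normL1 Ω u)) ∧
    -- for `α ≥ 1` no constant independent of `s` and `u` works, even one depending on `R` and `α`
    (∀ R : ℝ, (∀ x ∈ Ω, BoundaryHardy.bdist Ω x < R) → ∀ α : ℝ, 1 ≤ α →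
      ¬ ∃ C : ℝ, 0 < C ∧ ∀ s : ℝ, 1 / 2 ≤ s → s < 1 →
        ∀ u : EuclideanSpace ℝ (Fin (n + 1)) → ℝ, BoundaryHardy.MemWs1 s Ω u →
          BoundaryHardy.hardySeries s R α Ω u ≤
            ENNReal.ofReal C *
              (ENNReal.ofReal (1 - s) * BoundaryHardy.gagliardo s Ω u +
                BoundaryHardy.normL1 Ω u)) := by
  obtain ⟨C, hC, hle⟩ := hΩ.exists_hardyInt_le
  have hle' : ∀ R : ℝ, (∀ x ∈ Ω, BoundaryHardy.bdist Ω x < R) →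
      ∀ m : ℕ, 2 ≤ m → ∀ s : ℝ, 1 / 2 ≤ s → s < 1 →
      ∀ u : EuclideanSpace ℝ (Fin (n + 1)) → ℝ, BoundaryHardy.MemWs1 s Ω u →
        BoundaryHardy.hardyInt s R m Ω u ≤
          ENNReal.ofReal (C * 2 ^ m) *
            (ENNReal.ofReal (1 - s) * BoundaryHardy.gagliardo s Ω u +
              BoundaryHardy.normL1 Ω u) := by
    intro R hR m hm s hs0 hs u hu
    refine (hle R hR m (by omega) s (by linarith) hs u hu).trans
      (mul_le_mul_left (ENNReal.ofReal_le_ofReal ?_) _)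
    exact le_mul_of_one_le_right hC.le (one_le_pow₀ (by norm_num))
  refine ⟨⟨C, hC, hle'⟩, ⟨C, hC, ?_⟩, fun R hR α hα => hΩ.not_exists_hardySeries_le hR hα⟩
  intro R hR α hα0 hα s hs0 hs u hu
  exact BoundaryHardy.hardySeries_le_of_hardyInt_le hC.le hα0 hα
    fun m hm => hle' R hR m hm s hs0 hs u hu
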